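/- Fix a countably infinite domain $D$ of values (constants and nulls). A *schema* is a finite set of relation symbols, each of a fixed positive arity; distinct schemas have no symbols in common. An *instance* of a schema assigns to each $n$-ary symbol a finite subset of $D^n$. A *schema mapping* from $\mathbf S$ to $\mathbf T$ is a set of pairs $(I,J)$ with $I$ an instance of $\mathbf S$ and $J$ an instance of $\mathbf T$; two mappings are *equivalent* if they are equal as sets of pairs, and $\mathcal M\circ\mathcal M'=\{(I,K):\exists J,\ (I,J)\in\mathcal M,\ (J,K)\in\mathcal M'\}$. An *st-tgd* from $\mathbf S$ to $\mathbf T$ is a sentence $\forall\bar x(\varphi(\bar x)\to\exists\bar y\,\psi(\bar x,\bar y))$ with $\varphi$ a conjunction of relational atoms over $\mathbf S$ and $\psi$ one over $\mathbf T$; a *t-tgd* over $\mathbf T$ is the same with both $\varphi$ and $\psi$ over $\mathbf T$; a *t-egd* over $\mathbf T$ is a sentence $\forall\bar x(\varphi(\bar x)\to u=v)$ with $\varphi$ a conjunction of relational atoms over $\mathbf T$ and $u,v$ among $\bar x$. In all three, every variable of $\bar x$ occurs in an atom of $\varphi$. Conjunctions may be empty. The dependency graph of a finite set $\Gamma$ of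 t-tgds over $\mathbf T$ has as nodes the positions $(T,i)$, for $T$ a symbol of $\mathbf T$ and $1\le i\le\operatorname{arity}(T)$. For each t-tgd $\forall\bar x(\varphi\to\exists\bar y\,\psi)$ in $\Gamma$ and each $x$ in $\bar x$ occurring in $\varphi$ at position $p$, there is an edge from $p$ to every position at which $x$ occurs in $\psi$, and a special edge from $p$ to every position at which some variable of $\bar y$ occurs in $\psi$. The set $\Gamma$ is *weakly acyclic* if no cycle contains a special edge. A *standard schema mapping* from $\mathbf S$ to $\mathbf T$ is the set of all pairs $(I,J)$ that satisfy a given finite set of st-tgds, with $J$ satisfying a given finite set of t-egds and a given finite weakly acyclic set of t-tgds. An *st-SO dependency* from $\mathbf S$ to $\mathbf T$ is a formula $\exists\bar f\,\bigl(\bigwedge_{i=1}^n\forall\bar x_i(\varphi_i\to\psi_i)\bigr)$, where $\bar f$ is a finite tuple of function symbols, $\varphi_i$ is a conjunction of relational atoms over $\mathbf S$ in the variables $\bar x_i$ and of equalities between terms built from $\bar x_i$ and $\bar f$, $\psi_i$ is a conjunction of relational atoms over $\mathbf T$ in such terms and of equalities between such terms, and every variable of $\bar x_i$ occurs in a relational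 atom of $\varphi_i$. The pair $(I,J)$ satisfies it if it holds, in the usual sense of second-order logic, with the functions $\bar f$ ranging over functions on the universe $D$. The depth of nesting is $0$ for variables and $0$-ary function symbols, and one more than the maximal depth of the arguments for any other term; the dependency is *unnested* if all its terms have depth at most $1$. **Statement.** Let $k\ge1$, let $\mathbf S_0,\dots,\mathbf S_k$ be schemas, let $\mathcal M_{i}$ be a standard schema mapping from $\mathbf S_{i-1}$ to $\mathbf S_{i}$ for $1\le i\le k$, and let $\mathcal M=\mathcal M_1\circ\cdots\circ\mathcal M_k$. Then: 1. There are an unnested st-SO dependency $\sigma$ from $\mathbf S_0$ to $\mathbf S_k$, a finite set $\Sigma_e$ of t-egds over $\mathbf S_k$ and a finite weakly acyclic set $\Sigma_t$ of t-tgds over $\mathbf S_k$ such that $(I,J)\in\mathcal M$ if and only if $(I,J)$ satisfies $\sigma$ and $J$ satisfies $\Sigma_e\cup\Sigma_t$. 2. There are a schema $\mathbf R$, a standard schema mapping $\mathcal N_1$ from $\mathbf S_0$ to $\mathbf R$ that is specified by st-tgds and t-egds only (no t-tgds), and a standard schema mapping $\mathcal N_2$ from $\mathbf R$ to $\mathbf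 S_k$, such that $\mathcal M=\mathcal N_1\circ\mathcal N_2$. -/

import Mathlib

namespace DataExchange

/-! ### Schemas and instances -/

/-- A schema: finitely many relation symbols, each with a fixed positive arity. Two schemas are
always regarded as having no relation symbol in common. -/
structure Schema : Type 1 where
  Rel : Type
  [finite_rel : Finite Rel]
  arity : Rel → ℕ
  arity_pos : ∀ R, 0 < arity R

attribute [instance] Schema.finite_rel

/-- An instance of a schema over the value domain `D` (the constants together with the nulls):
a finite relation of the right arity for every relation symbol. -/
@[ext]
structure Inst (S : Schema) (D : Type*) where
  rel : (R : S.Rel) → Set (Fin (S.arity R) → D)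
  finite : ∀ R, (rel R).Finite

/-- A schema mapping from `S` to `T`: a set of pairs of instances. Two schema mappings are
equivalent when they are equal as sets of pairs. The composition `M₁ ∘ M₂` (first `M₁`, then
`M₂`) is `SetRel.comp M₁ M₂`. -/
abbrev SchemaMapping (D : Type*) (S T : Schema) := SetRel (Inst S D) (Inst T D)

/-- A relational atom `R(t₁, …, tₙ)` whose arguments are taken from `τ` (variables or terms). -/
structure Atom (S : Schema) (τ : Type) where
  rel : S.Rel
  args : Fin (S.arity rel) → τ

namespace Atom

variable {S : Schema} {τ : Type} {D : Type*}

/-- The atom is true in `I` when its arguments are evaluated by `v`. -/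
def Holds (A : Atom S τ) (I : Inst S D) (v : τ → D) : Prop :=
  (fun i => v (A.args i)) ∈ I.rel A.rel

/-- `x` occurs in the atom. -/
def Mentions (A : Atom S τ) (x : τ) : Prop := ∃ i, A.args i = x

/-- `x` occurs in the atom at the position `p = (R, i)`. -/
def OccursAt (A : Atom S τ) (x : τ) (p : (R : S.Rel) × Fin (S.arity R)) : Prop :=
  ∃ i, p = ⟨A.rel, i⟩ ∧ A.args i = x

end Atom

/-! ### First-order dependencies -/

/-- A tuple-generating dependency `∀ x̄ (φ(x̄) → ∃ ȳ ψ(x̄, ȳ))` with `φ` a conjunction of atoms over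
`S`, `ψ` a conjunction of atoms over `T`, and every variable of `x̄` occurring in an atom of `φ`.
It is an st-tgd when `S` is the source schema and `T` the target schema; a t-tgd over `T` is a
`Tgd T T`. -/
structure Tgd (S T : Schema) : Type 1 where
  /-- the universally quantified variables `x̄` -/
  U : Type
  /-- the existentially quantified variables `ȳ` -/
  E : Type
  [finite_U : Finite U]
  [finite_E : Finite E]
  premise : List (Atom S U)
  conclusion : List (Atom T (U ⊕ E))
  safe : ∀ x : U, ∃ A ∈ premise, A.Mentions x

attribute [instance] Tgd.finite_U Tgd.finite_E

/-- `(I, J)` satisfies the tgd. -/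
def Tgd.Sat {S T : Schema} {D : Type*} (d : Tgd S T) (I : Inst S D) (J : Inst T D) : Prop :=
  ∀ v : d.U → D, (∀ A ∈ d.premise, A.Holds I v) →
    ∃ w : d.E → D, ∀ B ∈ d.conclusion, B.Holds J (Sum.elim v w)

/-- A target equality-generating dependency `∀ x̄ (φ(x̄) → u = v)`, with `u`, `v` among `x̄` and every
variable of `x̄` occurring in an atom of `φ`. -/
structure Egd (T : Schema) : Type 1 where
  U : Type
  [finite_U : Finite U]
  premise : List (Atom T U)
  lhs : U
  rhs : U
  safe : ∀ x : U, ∃ A ∈ premise, A.Mentions x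

attribute [instance] Egd.finite_U

/-- `J` satisfies the egd. -/
def Egd.Sat {T : Schema} {D : Type*} (d : Egd T) (J : Inst T D) : Prop :=
  ∀ v : d.U → D, (∀ A ∈ d.premise, A.Holds J v) → v d.lhs = v d.rhs

/-! ### Weak acyclicity -/

section WeakAcyclicity

variable {T : Schema}

/-- The ordinary edges of the dependency graph of a set of t-tgds: some universally quantified
variable occurs at `p` in the premise and at `q` in the conclusion. -/
def Edge (Γ : List (Tgd T T)) (p q : (R : T.Rel) × Fin (T.arity R)) : Prop :=
  ∃ d ∈ Γ, ∃ x : d.U, (∃ A ∈ d.premise, A.OccursAt x p) ∧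
    ∃ B ∈ d.conclusion, B.OccursAt (Sum.inl x) q

/-- The special edges of the dependency graph: some universally quantified variable occurs at `p`
in the premise and some existentially quantified variable occurs at `q` in the conclusion. -/
def SpecialEdge (Γ : List (Tgd T T)) (p q : (R : T.Rel) × Fin (T.arity R)) : Prop :=
  ∃ d ∈ Γ, ∃ (x : d.U) (y : d.E), (∃ A ∈ d.premise, A.OccursAt x p) ∧
    ∃ B ∈ d.conclusion, B.OccursAt (Sum.inr y) q

/-- No cycle of the dependency graph goes through a special edge. -/
def WeaklyAcyclic (Γ : List (Tgd T T)) : Prop :=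
  ∀ p q, SpecialEdge Γ p q →
    ¬ Relation.ReflTransGen (fun a b => Edge Γ a b ∨ SpecialEdge Γ a b) q p

end WeakAcyclicity

/-! ### Source-to-target second-order dependencies -/

/-- The depth of nesting of a term: `0` for variables and for 0-ary function symbols, and one more
than the maximal depth of the arguments otherwise. -/
def depth {L : FirstOrder.Language.{0, 0}} {V : Type} : L.Term V → ℕ
  | .var _ => 0
  | .func (l := n) _ ts => if n = 0 then 0 else (Finset.univ.sup fun i => depth (ts i)) + 1

/-- One conjunct `∀ x̄ (φ → ψ)` of an st-SO dependency with function symbols from `L`: `φ` is a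
conjunction of relational atoms over `S` in the variables and of equalities of terms, `ψ` is a
conjunction of relational atoms over `T` in terms and of equalities of terms, and every variable
occurs in a relational atom of `φ`. -/
structure SOClause (S T : Schema) (L : FirstOrder.Language.{0, 0}) : Type 1 where
  /-- the universally quantified variables `x̄` -/
  V : Type
  [finite_V : Finite V]
  premise : List (Atom S V)
  premiseEqs : List (L.Term V × L.Term V)
  conclusion : List (Atom T (L.Term V))
  conclusionEqs : List (L.Term V × L.Term V)
  safe : ∀ x : V, ∃ A ∈ premise, A.Mentions x

attribute [instance] SOClause.finite_V

namespace SOClause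

variable {S T : Schema} {L : FirstOrder.Language.{0, 0}}

/-- The conjunct is true of `(I, J)` under a given interpretation of the function symbols. -/
def Sat {D : Type*} [L.Structure D] (c : SOClause S T L) (I : Inst S D) (J : Inst T D) : Prop :=
  ∀ v : c.V → D,
    (∀ A ∈ c.premise, A.Holds I v) →
    (∀ e ∈ c.premiseEqs, e.1.realize v = e.2.realize v) →
      (∀ B ∈ c.conclusion, B.Holds J (fun t => t.realize v)) ∧
      (∀ e ∈ c.conclusionEqs, e.1.realize v = e.2.realize v)

/-- Every term in the conjunct has depth of nesting at most one. -/
def Unnested (c : SOClause S T L) : Prop :=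
  (∀ e ∈ c.premiseEqs, depth e.1 ≤ 1 ∧ depth e.2 ≤ 1) ∧
  (∀ B ∈ c.conclusion, ∀ i, depth (B.args i) ≤ 1) ∧
  (∀ e ∈ c.conclusionEqs, depth e.1 ≤ 1 ∧ depth e.2 ≤ 1)

end SOClause

/-- An st-SO dependency `∃ f̄ (∀ x̄₁ (φ₁ → ψ₁) ∧ ⋯ ∧ ∀ x̄ₙ (φₙ → ψₙ))` from `S` to `T`: a finite set of
function symbols (a language with finitely many function symbols and no relation symbols) and
finitely many conjuncts. -/
structure SODep (S T : Schema) : Type 1 where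
  L : FirstOrder.Language.{0, 0}
  [algebraic : L.IsAlgebraic]
  [finite_functions : Finite ((n : ℕ) × L.Functions n)]
  clauses : List (SOClause S T L)

attribute [instance] SODep.algebraic SODep.finite_functions

namespace SODep

variable {S T : Schema}

/-- `(I, J)` satisfies the st-SO dependency: the function symbols can be interpreted, as functions
on the universe, so that all conjuncts hold. The universe is a countably infinite set that includes
the active domains of `I` and `J`; it is taken to be the whole (countably infinite) domain `D`.
Any two such universes are in bijection over the finite set of active values, so that the choice
does not matter. -/
def Sat {D : Type*} (σ : SODep S T) (I : Inst S D) (J : Inst T D) : Prop :=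
  ∃ _ : σ.L.Structure D, ∀ c ∈ σ.clauses, c.Sat I J

/-- The depth of nesting of the dependency is at most one. -/
def Unnested (σ : SODep S T) : Prop := ∀ c ∈ σ.clauses, c.Unnested

end SODep

/-! ### Classes of schema mappings -/

section Mappings

variable {D : Type*} {S T : Schema}

/-- The mapping specified by a finite set of st-tgds, a finite set of t-egds and a finite set of
t-tgds. -/
def specifiedBy (st : List (Tgd S T)) (egds : List (Egd T)) (tgds : List (Tgd T T)) :
    SchemaMapping D S T :=
  {p | (∀ d ∈ st, d.Sat p.1 p.2) ∧ (∀ d ∈ egds, d.Sat p.2) ∧ (∀ d ∈ tgds, d.Sat p.2 p.2)}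

/-- The mapping specified by an st-SO dependency, a finite set of t-egds and a finite set of
t-tgds. -/
def specifiedBySO (σ : SODep S T) (egds : List (Egd T)) (tgds : List (Tgd T T)) :
    SchemaMapping D S T :=
  {p | σ.Sat p.1 p.2 ∧ (∀ d ∈ egds, d.Sat p.2) ∧ (∀ d ∈ tgds, d.Sat p.2 p.2)}

/-- Standard schema mappings: specified by st-tgds, t-egds and a weakly acyclic set of t-tgds. -/
def IsStandard (M : SchemaMapping D S T) : Prop :=
  ∃ (st : List (Tgd S T)) (egds : List (Egd T)) (tgds : List (Tgd T T)),
    WeaklyAcyclic tgds ∧ M = specifiedBy st egds tgds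

/-- Standard schema mappings whose target constraints are only t-egds (no t-tgds). -/
def IsStandardEgdOnly (M : SchemaMapping D S T) : Prop :=
  ∃ (st : List (Tgd S T)) (egds : List (Egd T)), M = specifiedBy st egds []

/-- Mappings specified by an unnested st-SO dependency, along with t-egds and a weakly acyclic set
of t-tgds. -/
def IsUnnestedSOStandard (M : SchemaMapping D S T) : Prop :=
  ∃ (σ : SODep S T) (egds : List (Egd T)) (tgds : List (Tgd T T)),
    σ.Unnested ∧ WeaklyAcyclic tgds ∧ M = specifiedBySO σ egds tgds

end Mappings

/-- The compositions `M₁ ∘ M₂ ∘ ⋯ ∘ Mₖ` (`k ≥ 1`) of finitely many standard schema mappings. -/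
inductive IsStandardComposition {D : Type*} :
    {S T : Schema} → SchemaMapping D S T → Prop
  | single {S T : Schema} {M : SchemaMapping D S T} (hM : IsStandard M) :
      IsStandardComposition M
  | comp {S R T : Schema} {M : SchemaMapping D S R} {N : SchemaMapping D R T}
      (hM : IsStandard M) (hN : IsStandardComposition N) :
      IsStandardComposition (SetRel.comp M N)

end DataExchange

/-! To compose is to eliminate an intermediate finite instance `J` from the statement that `(I, J)`
lies in a standard mapping and `(J, K)` satisfies a second-order dependency `σ` with flat terms. The
values of `J` that matter are Skolem terms over the active domain of `I`. Weak acyclicity ranks the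
positions, and the ranks bound the depth of the terms needed, so that finitely many shapes of terms
suffice.

Nesting is avoided by giving every shape a function symbol of its own, applied directly to the
leaves. Further symbols, again one for each choice of argument shapes, give the characteristic
functions of the relations of `J` and the functions of `σ` at the values of terms. The constraints,
the clauses of `σ` and the congruence of these last two kinds of symbols are then finitely many
implications with flat terms (`StepSat`, `clausal_stepSat`). The Skolem functions themselves need
not respect equality of values: a tgd asks only for some witness, and any representatives of the
premise supply one. `exists_stepSat` reads such functions off `J`; `StepSat.exists_inst` rebuilds a
possibly different `J` from them. Hence `FlatDep.exists_comp`, and by induction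
`IsStandardComposition.exists_flatDep`, where the target constraints of the last mapping are carried
along untouched. Flat terms have depth at most one, which gives the first claim.

For the second claim, the intermediate schema stores a copy of the source and the graphs of the
functions. Tgds make the functions total on source values and egds make them single-valued. A clause
then becomes an egd if its head is an equality and a tgd into the target if its head is an atom;
equalities in its premise are absorbed by identifying variables (`FlatDep.exists_graph_of_sat`,
`FlatDep.sat_of_graph`). -/

namespace DataExchange

/-! ### Finite enumerations, active domains -/

/-- A list of all elements of a finite type. -/
noncomputable def enum (ι : Type*) [Finite ι] : List ι :=
  (@Finset.univ ι (Fintype.ofFinite ι)).toList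

@[simp]
theorem mem_enum {ι : Type*} [Finite ι] (i : ι) : i ∈ enum ι := by
  simp [enum]

/-- The positions of a schema. -/
abbrev Schema.Pos (S : Schema) : Type := (R : S.Rel) × Fin (S.arity R)

/-- Renaming the arguments of an atom. -/
def Atom.map {S : Schema} {τ τ' : Type} (f : τ → τ') (A : Atom S τ) : Atom S τ' :=
  ⟨A.rel, f ∘ A.args⟩

theorem Atom.holds_map {S : Schema} {τ τ' : Type} {D : Type*} (f : τ → τ') (A : Atom S τ)
    (I : Inst S D) (v : τ' → D) : (A.map f).Holds I v ↔ A.Holds I (v ∘ f) := Iff.rfl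

theorem Atom.Mentions.map {S : Schema} {τ τ' : Type} {A : Atom S τ} {x : τ}
    (h : A.Mentions x) (f : τ → τ') : (A.map f).Mentions (f x) := by
  obtain ⟨i, rfl⟩ := h
  exact ⟨i, rfl⟩

/-- The active domain of an instance. -/
def Inst.adom {S : Schema} {D : Type*} (I : Inst S D) : Set D :=
  {a | ∃ p : S.Pos, ∃ w ∈ I.rel p.1, w p.2 = a}

theorem Inst.finite_adom {S : Schema} {D : Type*} (I : Inst S D) : I.adom.Finite := by
  have : I.adom = ⋃ p : S.Pos, (fun w => w p.2) '' I.rel p.1 := by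
    ext a
    simp [Inst.adom]
  rw [this]
  exact Set.finite_iUnion fun p => (I.finite p.1).image _

instance {S : Schema} {D : Type*} (I : Inst S D) : Finite I.adom := I.finite_adom

theorem Atom.Holds.mem_adom {S : Schema} {τ : Type} {D : Type*} {A : Atom S τ} {I : Inst S D}
    {v : τ → D} (h : A.Holds I v) {x : τ} (hx : A.Mentions x) : v x ∈ I.adom := by
  obtain ⟨i, rfl⟩ := hx
  exact ⟨⟨A.rel, i⟩, _, h, rfl⟩

/-! ### Flat second-order dependencies -/

/-- A finite set of function symbols, each with a finite type indexing its arguments. -/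
structure Signature : Type 1 where
  Sym : Type
  Arg : Sym → Type
  [finite_sym : Finite Sym]
  [finite_arg : ∀ f, Finite (Arg f)]

attribute [instance] Signature.finite_sym Signature.finite_arg

/-- An interpretation of the function symbols on `D`. -/
abbrev Signature.Interp (F : Signature) (D : Type*) := ∀ f : F.Sym, (F.Arg f → D) → D

/-- A variable, or a function symbol applied to variables. -/
inductive FlatTerm (F : Signature) (V : Type) : Type
  | var (x : V)
  | app (f : F.Sym) (xs : F.Arg f → V)

namespace FlatTerm

variable {F : Signature} {V W : Type} {D : Type*}

instance [Finite V] : Finite (FlatTerm F V) := by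
  refine Finite.of_surjective
    (fun p : V ⊕ (f : F.Sym) × (F.Arg f → V) => Sum.elim var (fun q => app q.1 q.2) p) ?_
  rintro (x | ⟨f, xs⟩)
  · exact ⟨.inl x, rfl⟩
  · exact ⟨.inr ⟨f, xs⟩, rfl⟩

/-- The value of a flat term. -/
def eval (h : F.Interp D) (v : V → D) : FlatTerm F V → D
  | var x => v x
  | app f xs => h f (v ∘ xs)

/-- Renaming the variables of a flat term. -/
def map (g : V → W) : FlatTerm F V → FlatTerm F W
  | var x => var (g x)
  | app f xs => app f (g ∘ xs)

theorem eval_map (h : F.Interp D) {v : W → D} {g : V → W} {u : V → D} (hu : v ∘ g = u)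
    (t : FlatTerm F V) : (t.map g).eval h v = t.eval h u := by
  subst hu
  cases t <;> rfl

end FlatTerm

/-- The head of a flat clause: an equality, or an atom over the target. -/
inductive Head (T : Schema) (F : Signature) (V : Type) : Type
  | eq (s t : FlatTerm F V)
  | atom (B : Atom T (FlatTerm F V))

namespace Head

variable {T : Schema} {F : Signature} {V W : Type} {D : Type*}

/-- The head is true under a valuation of the variables. -/
def Holds (h : F.Interp D) (J : Inst T D) (v : V → D) : Head T F V → Prop
  | eq s t => s.eval h v = t.eval h v
  | atom B => B.Holds J (FlatTerm.eval h v)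

/-- Renaming the variables of a head. -/
def map (g : V → W) : Head T F V → Head T F W
  | eq s t => eq (s.map g) (t.map g)
  | atom B => atom (B.map (FlatTerm.map g))

theorem holds_map (h : F.Interp D) (J : Inst T D) {v : W → D} {g : V → W} {u : V → D}
    (hu : v ∘ g = u) (c : Head T F V) : (c.map g).Holds h J v ↔ c.Holds h J u := by
  cases c with
  | eq s t => simp only [map, Holds, FlatTerm.eval_map h hu]
  | atom B =>
    simp only [map, Holds, Atom.holds_map]
    rw [show FlatTerm.eval h v ∘ FlatTerm.map g = FlatTerm.eval h u from
      funext fun t => FlatTerm.eval_map h hu t]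

end Head

/-- An implication from atoms over `S` and equalities of flat terms to a single head. -/
structure FlatClause (S T : Schema) (F : Signature) : Type 1 where
  V : Type
  [finite_V : Finite V]
  premise : List (Atom S V)
  eqs : List (FlatTerm F V × FlatTerm F V)
  head : Head T F V

attribute [instance] FlatClause.finite_V

namespace FlatClause

variable {S T : Schema} {F : Signature} {D : Type*}

/-- Every variable occurs in a relational atom of the premise. -/
def Safe (c : FlatClause S T F) : Prop := ∀ x : c.V, ∃ A ∈ c.premise, A.Mentions x

/-- The clause is true. -/
def Sat (c : FlatClause S T F) (h : F.Interp D) (I : Inst S D) (J : Inst T D) : Prop :=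
  ∀ v : c.V → D, (∀ A ∈ c.premise, A.Holds I v) →
    (∀ e ∈ c.eqs, e.1.eval h v = e.2.eval h v) → c.head.Holds h J v

/-- The clause is true when its variables range over the active domain of the source. -/
def GuardedSat (c : FlatClause S T F) (h : F.Interp D) (I : Inst S D) (J : Inst T D) : Prop :=
  ∀ v : c.V → I.adom, (∀ A ∈ c.premise, A.Holds I (Subtype.val ∘ v)) →
    (∀ e ∈ c.eqs, e.1.eval h (Subtype.val ∘ v) = e.2.eval h (Subtype.val ∘ v)) →
    c.head.Holds h J (Subtype.val ∘ v)

/-- The clause with every variable `x` placed at the position `g x` of an atom of its own. -/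
noncomputable def guard (c : FlatClause S T F) (g : c.V → S.Pos) : FlatClause S T F where
  V := (x : c.V) × Fin (S.arity (g x).1)
  premise := c.premise.map (Atom.map fun x => ⟨x, (g x).2⟩) ++
    (enum c.V).map fun x => ⟨(g x).1, fun i => ⟨x, i⟩⟩
  eqs := c.eqs.map fun e => (e.1.map fun x => ⟨x, (g x).2⟩, e.2.map fun x => ⟨x, (g x).2⟩)
  head := c.head.map fun x => ⟨x, (g x).2⟩

theorem guard_safe (c : FlatClause S T F) (g : c.V → S.Pos) : (c.guard g).Safe := by
  rintro ⟨x, i⟩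
  exact ⟨⟨(g x).1, fun i => ⟨x, i⟩⟩,
    List.mem_append_right _ (List.mem_map.2 ⟨x, mem_enum x, rfl⟩), i, rfl⟩

/-- A value is active exactly when it stands at some position of some tuple. Each variable receives
its own atom with otherwise fresh variables, so the positions and the tuples can be chosen
independently. This turns unsafe clauses over the active domain into finitely many safe ones. -/
theorem guardedSat_iff (c : FlatClause S T F) (h : F.Interp D) (I : Inst S D) (J : Inst T D) :
    c.GuardedSat h I J ↔ ∀ g, (c.guard g).Sat h I J := by
  constructor
  · intro H g v hA he
    have hA' : ∀ x, (fun i => v ⟨x, i⟩) ∈ I.rel (g x).1 := fun x =>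
      hA _ (List.mem_append_right _ (List.mem_map.2 ⟨x, mem_enum x, rfl⟩))
    refine (Head.holds_map _ _ rfl _).2
      (H (fun x => ⟨v ⟨x, (g x).2⟩, g x, _, hA' x, rfl⟩) ?_ ?_)
    · intro A hmem
      exact hA _ (List.mem_append_left _ (List.mem_map.2 ⟨A, hmem, rfl⟩))
    · intro e hmem
      exact ((FlatTerm.eval_map h rfl e.1).symm.trans (he _ (List.mem_map.2 ⟨e, hmem, rfl⟩))).trans
        (FlatTerm.eval_map h rfl e.2)
  · intro H v hA he
    choose g w hw hv using fun x => (v x).2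
    have hcomp : (fun p : (c.guard g).V => w p.1 p.2) ∘ (fun x => ⟨x, (g x).2⟩) =
        Subtype.val ∘ v := funext hv
    refine (Head.holds_map _ _ hcomp _).1 (H g (fun p => w p.1 p.2) ?_ ?_)
    · intro A hmem
      rcases List.mem_append.1 hmem with hmem | hmem
      · obtain ⟨A, hA', rfl⟩ := List.mem_map.1 hmem
        have := hA A hA'
        rw [← hcomp] at this
        exact this
      · obtain ⟨x, -, rfl⟩ := List.mem_map.1 hmem
        exact hw x
    · intro e hmem
      obtain ⟨e, he', rfl⟩ := List.mem_map.1 hmem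
      exact ((FlatTerm.eval_map h hcomp e.1).trans (he e he')).trans
        (FlatTerm.eval_map h hcomp e.2).symm

end FlatClause

/-- A second-order dependency all of whose terms are flat. -/
structure FlatDep (S T : Schema) : Type 1 where
  F : Signature
  clauses : List (FlatClause S T F)
  safe : ∀ c ∈ clauses, c.Safe

/-- `(I, J)` satisfies the dependency. -/
def FlatDep.Sat {S T : Schema} {D : Type*} (σ : FlatDep S T) (I : Inst S D) (J : Inst T D) :
    Prop :=
  ∃ h : σ.F.Interp D, ∀ c ∈ σ.clauses, c.Sat h I J

/-- A property of an interpretation and a pair of instances is clausal if it is given by finitely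
many clauses with variables ranging over the active domain of the source. -/
def Clausal {S T : Schema} {F : Signature} {D : Type*}
    (P : F.Interp D → Inst S D → Inst T D → Prop) : Prop :=
  ∃ l : List (FlatClause S T F), ∀ h I J, P h I J ↔ ∀ c ∈ l, c.GuardedSat h I J

namespace Clausal

variable {S T : Schema} {F : Signature} {D : Type*}
  {P Q : F.Interp D → Inst S D → Inst T D → Prop}

theorem clause (c : FlatClause S T F) : Clausal (D := D) c.GuardedSat :=
  ⟨[c], by simp⟩

theorem congr (hP : Clausal P) (h : ∀ h I J, Q h I J ↔ P h I J) : Clausal Q := by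
  obtain ⟨l, hl⟩ := hP
  exact ⟨l, fun f I J => (h f I J).trans (hl f I J)⟩

theorem and (hP : Clausal P) (hQ : Clausal Q) : Clausal fun h I J => P h I J ∧ Q h I J := by
  obtain ⟨l, hl⟩ := hP
  obtain ⟨l', hl'⟩ := hQ
  refine ⟨l ++ l', fun h I J => ?_⟩
  simp only [hl, hl', List.mem_append]
  exact ⟨fun H c hc => hc.elim (H.1 c) (H.2 c), fun H => ⟨fun c hc => H c (.inl hc),
    fun c hc => H c (.inr hc)⟩⟩

theorem forall_mem {α : Type*} (l : List α) {P : α → F.Interp D → Inst S D → Inst T D → Prop}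
    (hP : ∀ a ∈ l, Clausal (P a)) : Clausal fun h I J => ∀ a ∈ l, P a h I J := by
  induction l with
  | nil => exact ⟨[], by simp⟩
  | cons a l ih =>
    refine ((hP a (by simp)).and (ih fun b hb => hP b (by simp [hb]))).congr ?_
    simp

theorem imp_const {p : Prop} (hP : p → Clausal P) : Clausal fun h I J => p → P h I J := by
  by_cases hp : p
  · exact (hP hp).congr (by simp [hp])
  · exact ⟨[], by simp [hp]⟩

theorem forall_finite {ι : Type*} [Finite ι] {P : ι → F.Interp D → Inst S D → Inst T D → Prop}
    (hP : ∀ i, Clausal (P i)) : Clausal fun h I J => ∀ i, P i h I J :=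
  (forall_mem (enum ι) fun i _ => hP i).congr (by simp)

/-- Clausal properties define second-order dependencies. -/
theorem exists_flatDep (hP : Clausal P) :
    ∃ σ : FlatDep S T, ∀ I J, σ.Sat I J ↔ ∃ h : F.Interp D, P h I J := by
  obtain ⟨l, hl⟩ := hP
  refine ⟨⟨F, l.flatMap fun c => (enum (c.V → S.Pos)).map c.guard, ?_⟩, fun I J => ?_⟩
  · intro c hc
    simp only [List.mem_flatMap, List.mem_map] at hc
    obtain ⟨c, -, g, -, rfl⟩ := hc
    exact c.guard_safe g
  · refine exists_congr fun h => ?_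
    simp only [hl, FlatClause.guardedSat_iff, List.mem_flatMap, List.mem_map]
    constructor
    · intro H c hc g
      exact H _ ⟨c, hc, g, mem_enum g, rfl⟩
    · rintro H _ ⟨c, hc, g, -, rfl⟩
      exact H c hc g

end Clausal

/-! ### Ranks of positions -/

/-- The positions of a weakly acyclic set of tgds have ranks that do not decrease along edges and
increase along special edges. -/
theorem WeaklyAcyclic.exists_rank {T : Schema} {Γ : List (Tgd T T)} (hΓ : WeaklyAcyclic Γ) :
    ∃ r : T.Pos → ℕ, (∀ p q, Edge Γ p q → r p ≤ r q) ∧ ∀ p q, SpecialEdge Γ p q → r p < r q := by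
  set E : T.Pos → T.Pos → Prop := fun a b => Edge Γ a b ∨ SpecialEdge Γ a b
  let lt : T.Pos → T.Pos → Prop := fun p q =>
    ∃ a b, Relation.ReflTransGen E p a ∧ SpecialEdge Γ a b ∧ Relation.ReflTransGen E b q
  have hsub : ∀ p q, E p q → {x | lt x p} ⊆ {x | lt x q} := by
    rintro p q hpq x ⟨a, b, hxa, hab, hbp⟩
    exact ⟨a, b, hxa, hab, hbp.tail hpq⟩
  -- The rank of `q` counts the positions from which `q` is reached by a path through a special
  -- edge.
  refine ⟨fun q => {p | lt p q}.ncard, fun p q h => Set.ncard_le_ncard (hsub p q (.inl h))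
    (Set.toFinite _), fun p q h => Set.ncard_lt_ncard ?_ (Set.toFinite _)⟩
  -- Strictness: `p` is counted for `q`, but counting it for `p` would close a cycle through a
  -- special edge.
  refine ⟨hsub p q (.inr h), fun hqp => ?_⟩
  obtain ⟨a, b, hpa, hab, hbp⟩ := hqp (show lt p q from ⟨p, q, .refl, h, .refl⟩)
  exact hΓ a b hab (hbp.trans hpa)


/-! ### Shapes of Skolem terms -/

/-- The shapes of terms over Skolem functions `k` with arguments indexed by `U k`. -/
inductive Shape (K : Type) (U : K → Type) : Type
  | var
  | node (k : K) (c : U k → Shape K U)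

namespace Shape

variable {K : Type} {U : K → Type} {D : Type*}

/-- The leaves of a shape. -/
def Arg : Shape K U → Type
  | var => Unit
  | node k c => (u : U k) × (c u).Arg

instance finite_arg [∀ k, Finite (U k)] (t : Shape K U) : Finite t.Arg := by
  induction t with
  | var => exact inferInstanceAs (Finite Unit)
  | node k c ih => exact inferInstanceAs (Finite ((u : U k) × (c u).Arg))

/-- The value of a term with a given shape. -/
def eval (s : ∀ k, (U k → D) → D) : (t : Shape K U) → (t.Arg → D) → D
  | var, a => a ()
  | node k c, a => s k fun u => (c u).eval s fun i => a ⟨u, i⟩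

/-- The shapes of depth at most `n`. -/
def level : ℕ → Set (Shape K U)
  | 0 => {var}
  | n + 1 => {t | t = var ∨ ∃ k c, (∀ u, c u ∈ level n) ∧ node k c = t}

theorem var_mem_level (n : ℕ) : (var : Shape K U) ∈ level n := by
  cases n
  · rfl
  · exact .inl rfl

theorem node_mem_level {n : ℕ} {k : K} {c : U k → Shape K U} (h : ∀ u, c u ∈ level n) :
    node k c ∈ level (n + 1) := .inr ⟨k, c, h, rfl⟩

theorem level_subset_succ (n : ℕ) : (level n : Set (Shape K U)) ⊆ level (n + 1) := by
  induction n with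
  | zero =>
    rintro _ rfl
    exact .inl rfl
  | succ n ih =>
    rintro t (rfl | ⟨k, c, hc, rfl⟩)
    · exact .inl rfl
    · exact node_mem_level fun u => ih (hc u)

theorem level_mono : Monotone (level : ℕ → Set (Shape K U)) :=
  monotone_nat_of_le_succ level_subset_succ

/-- Bounding the depth is what makes the signature of a composition finite. -/
instance finite_level [Finite K] [∀ k, Finite (U k)] (n : ℕ) :
    Finite (level n : Set (Shape K U)) := by
  induction n with
  | zero => exact inferInstanceAs (Finite ({var} : Set (Shape K U)))
  | succ n ih =>
    have hs : (level (n + 1) : Set (Shape K U)) ⊆ {var} ∪ Set.range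
        fun p : (k : K) × (U k → (level n : Set (Shape K U))) => node p.1 fun u => (p.2 u).1 := by
      rintro t (rfl | ⟨k, c, hc, rfl⟩)
      · exact .inl rfl
      · exact .inr ⟨⟨k, fun u => ⟨c u, hc u⟩⟩, rfl⟩
    exact Set.Finite.subset ((Set.finite_singleton _).union (Set.finite_range _)) hs

end Shape

/-- The shapes of depth at most `n`, as a type. -/
abbrev Level (K : Type) (U : K → Type) (n : ℕ) : Type := (Shape.level n : Set (Shape K U))

/-- Terms of depth at most `n` with leaves labelled by `V`. -/
abbrev Rep (K : Type) (U : K → Type) (n : ℕ) (V : Type*) := (t : Level K U n) × (t.1.Arg → V)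

namespace Rep

variable {K : Type} {U : K → Type} {n : ℕ} {V W X : Type*}

/-- Relabelling the leaves. -/
def map (g : V → W) (ρ : Rep K U n V) : Rep K U n W := ⟨ρ.1, g ∘ ρ.2⟩

/-- A single leaf. -/
def var (x : V) : Rep K U n V := ⟨⟨.var, Shape.var_mem_level n⟩, fun _ => x⟩

/-- Regarding a term of depth at most `n` as one of depth at most `n + 1`. -/
def succ (ρ : Rep K U n V) : Rep K U (n + 1) V := ⟨⟨ρ.1.1, Shape.level_subset_succ n ρ.1.2⟩, ρ.2⟩

/-- Applying a Skolem function to terms. -/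
def node (k : K) (ρ : U k → Rep K U n V) : Rep K U (n + 1) V :=
  ⟨⟨.node k fun u => (ρ u).1.1, Shape.node_mem_level fun u => (ρ u).1.2⟩,
    fun p => (ρ p.1).2 p.2⟩

theorem exists_succ_eq {ρ : Rep K U (n + 1) V} (h : ρ.1.1 ∈ Shape.level n) :
    ∃ ρ' : Rep K U n V, ρ'.succ = ρ := ⟨⟨⟨ρ.1.1, h⟩, ρ.2⟩, rfl⟩

/-- Terms of given shapes with distinct labels. -/
def generic {X : Type} (t : X → Level K U n) (x : X) : Rep K U n ((x : X) × (t x).1.Arg) :=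
  ⟨t x, fun i => ⟨x, i⟩⟩

/-- A family of terms amounts to a choice of shapes and a labelling of the disjoint union of their
leaves. For finite `X` and finitely many shapes, a quantifier over terms thus becomes a finite
conjunction of statements quantified over leaf values only, which is the form of a clause. -/
theorem forall_iff {X : Type} {P : (X → Rep K U n V) → Prop} :
    (∀ ρ, P ρ) ↔ ∀ (t : X → Level K U n) (v : (x : X) × (t x).1.Arg → V),
      P fun x => (generic t x).map v :=
  ⟨fun H _ _ => H _, fun H ρ => H (fun x => (ρ x).1) fun p => (ρ p.1).2 p.2⟩

end Rep

/-! ### The function symbols for a composition -/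

/-- The function symbols used to describe an intermediate instance over `R` whose values are
given by terms of depth at most `n`, along with functions from `F` on these values. -/
inductive CompSym (K : Type) (U : K → Type) (R : Schema) (F : Signature) (n : ℕ) : Type
  /-- the value of a term -/
  | val (t : Level K U n)
  /-- the truth value -/
  | tru
  /-- the characteristic function of a relation -/
  | chr (r : R.Rel) (t : Fin (R.arity r) → Level K U n)
  /-- a function applied to the values of terms -/
  | fn (f : F.Sym) (t : F.Arg f → Level K U n)

namespace CompSym

variable {K : Type} {U : K → Type} {R : Schema} {F : Signature} {n : ℕ}

/-- The arguments of the symbols. -/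
def Arg : CompSym K U R F n → Type
  | val t => t.1.Arg
  | tru => Empty
  | chr r t => (i : Fin (R.arity r)) × (t i).1.Arg
  | fn f t => (i : F.Arg f) × (t i).1.Arg

instance [Finite K] [∀ k, Finite (U k)] : Finite (CompSym K U R F n) := by
  refine Finite.of_surjective (fun p : (Level K U n ⊕ Unit) ⊕
      (((r : R.Rel) × (Fin (R.arity r) → Level K U n)) ⊕
        ((f : F.Sym) × (F.Arg f → Level K U n))) =>
    Sum.elim (Sum.elim val fun _ => tru)
      (Sum.elim (fun q => chr q.1 q.2) fun q => fn q.1 q.2) p) ?_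
  rintro (t | _ | ⟨r, t⟩ | ⟨f, t⟩)
  · exact ⟨.inl (.inl t), rfl⟩
  · exact ⟨.inl (.inr ()), rfl⟩
  · exact ⟨.inr (.inl ⟨r, t⟩), rfl⟩
  · exact ⟨.inr (.inr ⟨f, t⟩), rfl⟩

instance [∀ k, Finite (U k)] (s : CompSym K U R F n) : Finite s.Arg := by
  cases s with
  | val t => exact inferInstanceAs (Finite t.1.Arg)
  | tru => exact inferInstanceAs (Finite Empty)
  | chr r t => exact inferInstanceAs (Finite ((i : Fin (R.arity r)) × (t i).1.Arg))
  | fn f t => exact inferInstanceAs (Finite ((i : F.Arg f) × (t i).1.Arg))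

end CompSym

/-- The signature for a composition. -/
def compSig (K : Type) [Finite K] (U : K → Type) [∀ k, Finite (U k)] (R : Schema) (F : Signature)
    (n : ℕ) : Signature where
  Sym := CompSym K U R F n
  Arg := CompSym.Arg

/-! ### Substituting terms of bounded depth into flat terms and heads -/

namespace compSig

variable {K : Type} [Finite K] {U : K → Type} [∀ k, Finite (U k)] {S R T : Schema}
  {F : Signature} {n : ℕ} {D : Type*} {V : Type*} {X : Type}

/-- The value of a term. -/
def value (h : (compSig K U R F n).Interp D) (e : V → D) (ρ : Rep K U n V) : D :=
  h (CompSym.val ρ.1) (e ∘ ρ.2)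

/-- The characteristic function of the relation `r` says that a tuple of terms belongs to it. -/
def ChrHolds (h : (compSig K U R F n).Interp D) (e : V → D) (r : R.Rel)
    (ρ : Fin (R.arity r) → Rep K U n V) : Prop :=
  h (CompSym.chr r fun i => (ρ i).1) (e ∘ fun p => (ρ p.1).2 p.2) = h CompSym.tru (e ∘ Empty.elim)

/-- The value of a function at a tuple of terms. -/
def fnValue (h : (compSig K U R F n).Interp D) (e : V → D) (f : F.Sym)
    (ρ : F.Arg f → Rep K U n V) : D :=
  h (CompSym.fn f fun i => (ρ i).1) (e ∘ fun p => (ρ p.1).2 p.2)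

/-- The value of a flat term over `F` when terms are substituted for its variables. -/
def evalRep (h : (compSig K U R F n).Interp D) (e : V → D) (ρ : X → Rep K U n V) :
    FlatTerm F X → D
  | .var x => value h e (ρ x)
  | .app f xs => fnValue h e f (ρ ∘ xs)

/-- The truth value, as a flat term. -/
def truTerm {V : Type} : FlatTerm (compSig K U R F n) V := .app CompSym.tru Empty.elim

/-- The characteristic function of `r` at a tuple of terms, as a flat term. -/
def chrTerm {V : Type} (r : R.Rel) (ρ : Fin (R.arity r) → Rep K U n V) :
    FlatTerm (compSig K U R F n) V :=
  .app (CompSym.chr r fun i => (ρ i).1) fun p => (ρ p.1).2 p.2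

theorem eval_chrTerm {V : Type} (h : (compSig K U R F n).Interp D) (e : V → D) (r : R.Rel)
    (ρ : Fin (R.arity r) → Rep K U n V) :
    (chrTerm r ρ).eval h e = truTerm.eval h e ↔ ChrHolds h e r ρ := Iff.rfl

theorem chrHolds_map {W : Type*} (h : (compSig K U R F n).Interp D) (e : W → D) (g : V → W)
    (r : R.Rel) (ρ : Fin (R.arity r) → Rep K U n V) :
    ChrHolds h e r (fun i => (ρ i).map g) ↔ ChrHolds h (e ∘ g) r ρ := by
  have h0 : h CompSym.tru (e ∘ Empty.elim) = h CompSym.tru ((e ∘ g) ∘ Empty.elim) :=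
    congrArg _ (funext fun x => Empty.elim x)
  exact ⟨fun H => Eq.trans H h0, fun H => Eq.trans H h0.symm⟩

/-- A flat term over `F` with terms substituted for its variables, as a flat term. -/
def lift {V : Type} (ρ : X → Rep K U n V) : FlatTerm F X → FlatTerm (compSig K U R F n) V
  | .var x => .app (CompSym.val (ρ x).1) (ρ x).2
  | .app f xs => .app (CompSym.fn f fun i => (ρ (xs i)).1) fun p => (ρ (xs p.1)).2 p.2

theorem eval_lift {V : Type} (h : (compSig K U R F n).Interp D) (e : V → D)
    (ρ : X → Rep K U n V) (t : FlatTerm F X) :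
    (lift ρ t).eval h e = evalRep h e ρ t := by
  cases t <;> rfl

theorem evalRep_map {W : Type*} (h : (compSig K U R F n).Interp D) (e : W → D) (g : V → W)
    (ρ : X → Rep K U n V) (t : FlatTerm F X) :
    evalRep h e (fun x => (ρ x).map g) t = evalRep h (e ∘ g) ρ t := by
  cases t <;> rfl

/-- The truth of a head over `F` when terms are substituted for its variables. -/
def HeadRep (h : (compSig K U R F n).Interp D) (J : Inst T D) (e : V → D)
    (ρ : X → Rep K U n V) : Head T F X → Prop
  | .eq s t => evalRep h e ρ s = evalRep h e ρ t
  | .atom B => B.Holds J (evalRep h e ρ)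

/-- A head over `F` with terms substituted for its variables. -/
def liftHead {V : Type} (ρ : X → Rep K U n V) :
    Head T F X → Head T (compSig K U R F n) V
  | .eq s t => .eq (lift ρ s) (lift ρ t)
  | .atom B => .atom (B.map (lift ρ))

theorem holds_liftHead {V : Type} (h : (compSig K U R F n).Interp D) (J : Inst T D) (e : V → D)
    (ρ : X → Rep K U n V) (c : Head T F X) :
    (liftHead ρ c).Holds h J e ↔ HeadRep h J e ρ c := by
  cases c with
  | eq s t => simp only [liftHead, Head.Holds, HeadRep, eval_lift]
  | atom B =>
    simp only [liftHead, Head.Holds, HeadRep, Atom.holds_map]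
    rw [show FlatTerm.eval h e ∘ lift ρ = evalRep h e ρ from funext (eval_lift h e ρ)]

theorem headRep_map {W : Type*} (h : (compSig K U R F n).Interp D) (J : Inst T D) (e : W → D)
    (g : V → W) (ρ : X → Rep K U n V) (c : Head T F X) :
    HeadRep h J e (fun x => (ρ x).map g) c ↔ HeadRep h J (e ∘ g) ρ c := by
  cases c with
  | eq s t => simp only [HeadRep, evalRep_map]
  | atom B =>
    simp only [HeadRep]
    rw [show evalRep h e (fun x => (ρ x).map g) = evalRep h (e ∘ g) ρ from
      funext (evalRep_map h e g ρ)]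

/-- Implications from intermediate atoms and equalities, for terms of given shapes. -/
theorem clausal_of_shapes [Finite X] (prem : List (Atom R X))
    (eqs : List (FlatTerm F X × FlatTerm F X)) (t : X → Level K U n)
    (head : Head T (compSig K U R F n) ((x : X) × (t x).1.Arg)) :
    Clausal fun (h : (compSig K U R F n).Interp D) (I : Inst S D) (J : Inst T D) =>
      ∀ v : (x : X) × (t x).1.Arg → I.adom,
        (∀ A ∈ prem, ChrHolds h Subtype.val A.rel fun j =>
          (Rep.generic t (A.args j)).map v) →
        (∀ e ∈ eqs, evalRep h Subtype.val (fun x => (Rep.generic t x).map v) e.1 =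
          evalRep h Subtype.val (fun x => (Rep.generic t x).map v) e.2) →
        head.Holds h J (Subtype.val ∘ v) := by
  refine (Clausal.clause ⟨(x : X) × (t x).1.Arg, [],
    (prem.map fun A => (chrTerm A.rel fun j => Rep.generic t (A.args j), truTerm)) ++
      eqs.map fun e => (lift (Rep.generic t) e.1, lift (Rep.generic t) e.2), head⟩).congr ?_
  intro h I J
  refine forall_congr' fun v => ?_
  simp only [List.mem_append, List.mem_map, List.not_mem_nil, evalRep_map, ← eval_lift, chrHolds_map,
    ← eval_chrTerm]
  constructor
  · rintro H - he
    exact H (fun A hA => he _ (.inl ⟨A, hA, rfl⟩)) fun e hmem => he _ (.inr ⟨e, hmem, rfl⟩)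
  · intro H h1 h2
    refine H (by simp) ?_
    rintro e (⟨A, hA, rfl⟩ | ⟨e, hmem, rfl⟩)
    · exact h1 A hA
    · exact h2 e hmem

end compSig


/-! ### Composition of a standard mapping with a flat dependency -/

section Composition

variable {S R T : Schema} (st : List (Tgd S R)) (eg : List (Egd R)) (tg : List (Tgd R R))

/-- The Skolem functions of the tgds. -/
abbrev SkSym : Type :=
  ((i : Fin st.length) × (st.get i).E) ⊕ ((i : Fin tg.length) × (tg.get i).E)

/-- The arguments of the Skolem functions. -/
abbrev SkArg : SkSym st tg → Type
  | .inl p => (st.get p.1).U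
  | .inr p => (tg.get p.1).U

instance (k : SkSym st tg) : Finite (SkArg st tg k) := by
  rcases k with p | p
  · exact inferInstanceAs (Finite (st.get p.1).U)
  · exact inferInstanceAs (Finite (tg.get p.1).U)

variable {st tg} {F : Signature} {n : ℕ} {D : Type*} {V : Type*}

/-- Terms for the variables in the conclusion of a source-to-target tgd. -/
def stRep (i : Fin st.length) (a : (st.get i).U → V) :
    (st.get i).U ⊕ (st.get i).E → Rep (SkSym st tg) (SkArg st tg) (n + 1) V :=
  Sum.elim (fun x => .var (a x)) fun y => Rep.node (.inl ⟨i, y⟩) fun x => .var (a x)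

/-- Terms for the variables in the conclusion of a target tgd. -/
def tgRep (i : Fin tg.length) (ρ : (tg.get i).U → Rep (SkSym st tg) (SkArg st tg) n V) :
    (tg.get i).U ⊕ (tg.get i).E → Rep (SkSym st tg) (SkArg st tg) (n + 1) V :=
  Sum.elim (fun x => (ρ x).succ) fun y => Rep.node (.inr ⟨i, y⟩) ρ

/-- The signature for the composition. -/
abbrev stepSig (st : List (Tgd S R)) (tg : List (Tgd R R)) (F : Signature) (n : ℕ) : Signature :=
  compSig (SkSym st tg) (SkArg st tg) R F (n + 1)

open compSig

/-- The interpretation describes an intermediate instance that satisfies the constraints, along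
with an interpretation of `F` that satisfies the clauses. Variables of the target tgds take values
of bounded depth at chosen positions of their premises. -/
structure StepSat (cl : List (FlatClause R T F)) (ℓ : R.Pos → ℕ)
    (pos : ∀ i : Fin tg.length, (tg.get i).U → R.Pos)
    (h : (stepSig st tg F n).Interp D) (I : Inst S D) (J : Inst T D) : Prop where
  val_var : ∀ a : I.adom, value h Subtype.val (.var a) = a
  chr_congr : ∀ r (ρ : Fin (R.arity r) ⊕ Fin (R.arity r) → Rep _ _ _ I.adom),
    ChrHolds h Subtype.val r (ρ ∘ .inl) →
    (∀ i, value h Subtype.val (ρ (.inl i)) = value h Subtype.val (ρ (.inr i))) →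
    ChrHolds h Subtype.val r (ρ ∘ .inr)
  fn_congr : ∀ f (ρ : F.Arg f ⊕ F.Arg f → Rep _ _ _ I.adom),
    (∀ i, value h Subtype.val (ρ (.inl i)) = value h Subtype.val (ρ (.inr i))) →
    fnValue h Subtype.val f (ρ ∘ .inl) = fnValue h Subtype.val f (ρ ∘ .inr)
  st_sat : ∀ i, ∀ B ∈ (st.get i).conclusion, ∀ v : (st.get i).U → I.adom,
    (∀ A ∈ (st.get i).premise, A.Holds I (Subtype.val ∘ v)) →
    ChrHolds h Subtype.val B.rel (stRep i v ∘ B.args)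
  eg_sat : ∀ d ∈ eg, ∀ ρ : d.U → Rep _ _ _ I.adom,
    (∀ A ∈ d.premise, ChrHolds h Subtype.val A.rel (ρ ∘ A.args)) →
    value h Subtype.val (ρ d.lhs) = value h Subtype.val (ρ d.rhs)
  tg_sat : ∀ i, ∀ B ∈ (tg.get i).conclusion, ∀ ρ : (tg.get i).U → Rep _ _ n I.adom,
    (∀ x, (ρ x).1.1 ∈ Shape.level (ℓ (pos i x))) →
    (∀ A ∈ (tg.get i).premise, ChrHolds h Subtype.val A.rel fun j => (ρ (A.args j)).succ) →
    ChrHolds h Subtype.val B.rel (tgRep i ρ ∘ B.args)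
  cl_sat : ∀ c ∈ cl, ∀ ρ : c.V → Rep _ _ _ I.adom,
    (∀ A ∈ c.premise, ChrHolds h Subtype.val A.rel (ρ ∘ A.args)) →
    (∀ e ∈ c.eqs, evalRep h Subtype.val ρ e.1 = evalRep h Subtype.val ρ e.2) →
    HeadRep h J Subtype.val ρ c.head

variable {eg}

/-- Once the shapes of all terms are fixed, every condition is an implication between flat
equalities and source atoms in the leaves, and there are finitely many choices of shapes. -/
theorem clausal_stepSat (cl : List (FlatClause R T F)) (ℓ : R.Pos → ℕ)
    (pos : ∀ i : Fin tg.length, (tg.get i).U → R.Pos) :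
    Clausal (D := D) (StepSat (st := st) (n := n) eg cl ℓ pos) := by
  have h1 : Clausal fun (h : (stepSig st tg F n).Interp D) (I : Inst S D) (_ : Inst T D) =>
      ∀ a : I.adom, value h Subtype.val (.var a) = (a : D) := by
    refine (Clausal.clause ⟨Unit, [], [],
      .eq (lift (fun x : Unit => Rep.var x) (.var ())) (.var ())⟩).congr ?_
    intro h I J
    exact ⟨fun H v _ _ => H (v ()), fun H a => H (fun _ => a) (by simp) (by simp)⟩
  have h2 : Clausal fun (h : (stepSig st tg F n).Interp D) (I : Inst S D) (_ : Inst T D) =>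
      ∀ r (ρ : Fin (R.arity r) ⊕ Fin (R.arity r) → Rep _ _ _ I.adom),
      ChrHolds h Subtype.val r (ρ ∘ .inl) →
      (∀ i, value h Subtype.val (ρ (.inl i)) = value h Subtype.val (ρ (.inr i))) →
      ChrHolds h Subtype.val r (ρ ∘ .inr) := by
    simp only [Rep.forall_iff]
    refine Clausal.forall_finite fun r => Clausal.forall_finite fun t =>
      (clausal_of_shapes [⟨r, Sum.inl⟩] ((enum (Fin (R.arity r))).map fun i =>
        (.var (.inl i), .var (.inr i))) t
        (.eq (chrTerm r fun i => Rep.generic t (.inr i)) truTerm)).congr ?_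
    intro h I J
    refine forall_congr' fun v => ?_
    simp only [Head.Holds, eval_chrTerm, ← chrHolds_map, List.mem_map, mem_enum, true_and,
      List.mem_singleton, forall_eq, forall_exists_index, forall_apply_eq_imp_iff]
    rfl
  have h3 : Clausal fun (h : (stepSig st tg F n).Interp D) (I : Inst S D) (_ : Inst T D) =>
      ∀ f (ρ : F.Arg f ⊕ F.Arg f → Rep _ _ _ I.adom),
      (∀ i, value h Subtype.val (ρ (.inl i)) = value h Subtype.val (ρ (.inr i))) →
      fnValue h Subtype.val f (ρ ∘ .inl) = fnValue h Subtype.val f (ρ ∘ .inr) := by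
    simp only [Rep.forall_iff]
    refine Clausal.forall_finite fun f => Clausal.forall_finite fun t =>
      (clausal_of_shapes [] ((enum (F.Arg f)).map fun i =>
        (.var (.inl i), .var (.inr i))) t
        (liftHead (Rep.generic t) (.eq (.app f Sum.inl) (.app f Sum.inr)))).congr ?_
    intro h I J
    refine forall_congr' fun v => ?_
    simp only [holds_liftHead, ← headRep_map, List.mem_map, mem_enum, true_and,
      List.not_mem_nil, IsEmpty.forall_iff, implies_true, forall_const,
      forall_exists_index, forall_apply_eq_imp_iff]
    rfl
  have h4 : Clausal fun (h : (stepSig st tg F n).Interp D) (I : Inst S D) (_ : Inst T D) =>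
      ∀ i, ∀ B ∈ (st.get i).conclusion, ∀ v : (st.get i).U → I.adom,
      (∀ A ∈ (st.get i).premise, A.Holds I (Subtype.val ∘ v)) →
      ChrHolds h Subtype.val B.rel (stRep i v ∘ B.args) := by
    refine Clausal.forall_finite fun i => Clausal.forall_mem _ fun B _ =>
      (Clausal.clause ⟨(st.get i).U, (st.get i).premise, [],
        .eq (chrTerm B.rel (stRep i id ∘ B.args)) truTerm⟩).congr ?_
    intro h I J
    refine forall_congr' fun v => ?_
    have : stRep i v ∘ B.args =
        fun j => ((stRep i id ∘ B.args) j : Rep (SkSym st tg) (SkArg st tg) (n + 1) _).map v := by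
      funext j
      simp only [Function.comp_apply]
      cases B.args j <;> rfl
    simp only [Head.Holds, eval_chrTerm, ← chrHolds_map, this, List.not_mem_nil,
      IsEmpty.forall_iff, implies_true, forall_const]
  have h5 : Clausal fun (h : (stepSig st tg F n).Interp D) (I : Inst S D) (_ : Inst T D) =>
      ∀ d ∈ eg, ∀ ρ : d.U → Rep _ _ _ I.adom,
      (∀ A ∈ d.premise, ChrHolds h Subtype.val A.rel (ρ ∘ A.args)) →
      value h Subtype.val (ρ d.lhs) = value h Subtype.val (ρ d.rhs) := by
    simp only [Rep.forall_iff]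
    refine Clausal.forall_mem _ fun d _ => Clausal.forall_finite fun t =>
      (clausal_of_shapes d.premise [] t
        (liftHead (Rep.generic t) (.eq (.var d.lhs) (.var d.rhs)))).congr ?_
    intro h I J
    refine forall_congr' fun v => ?_
    simp only [holds_liftHead, ← headRep_map, List.not_mem_nil, IsEmpty.forall_iff, implies_true,
      forall_const]
    rfl
  have h6 : Clausal fun (h : (stepSig st tg F n).Interp D) (I : Inst S D) (_ : Inst T D) =>
      ∀ i, ∀ B ∈ (tg.get i).conclusion, ∀ ρ : (tg.get i).U → Rep _ _ n I.adom,
      (∀ x, (ρ x).1.1 ∈ Shape.level (ℓ (pos i x))) →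
      (∀ A ∈ (tg.get i).premise, ChrHolds h Subtype.val A.rel fun j => (ρ (A.args j)).succ) →
      ChrHolds h Subtype.val B.rel (tgRep i ρ ∘ B.args) := by
    simp only [Rep.forall_iff]
    refine Clausal.forall_finite fun i => Clausal.forall_mem _ fun B _ =>
      Clausal.forall_finite fun t => ?_
    let t' : (tg.get i).U → Level (SkSym st tg) (SkArg st tg) (n + 1) :=
      fun x => (Rep.generic t x).succ.1
    have hc := clausal_of_shapes (S := S) (T := T) (F := F) (D := D) (tg.get i).premise [] t'
      (.eq (chrTerm B.rel (tgRep i (Rep.generic t) ∘ B.args)) truTerm)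
    -- The depth restriction concerns the shapes alone, so for fixed shapes it is simply true or
    -- false and need not be expressed by a clause.
    refine (Clausal.imp_const (p := ∀ x, (t x).1 ∈ Shape.level (ℓ (pos i x)))
      fun _ => hc).congr ?_
    intro h I J
    have : ∀ v : (x : (tg.get i).U) × (t x).1.Arg → I.adom,
        tgRep i (fun x => (Rep.generic t x).map v) ∘ B.args =
        fun j => ((tgRep i (Rep.generic t) ∘ B.args) j :
          Rep (SkSym st tg) (SkArg st tg) (n + 1) _).map v := by
      intro v
      funext j
      simp only [Function.comp_apply]
      cases B.args j <;> rfl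
    have h7 : ∀ v : (x : (tg.get i).U) × (t x).1.Arg → I.adom,
        ChrHolds h Subtype.val B.rel (tgRep i (fun x => (Rep.generic t x).map v) ∘ B.args) ↔
        ChrHolds h (Subtype.val ∘ v) B.rel (tgRep i (Rep.generic t) ∘ B.args) := by
      intro v
      rw [this, chrHolds_map]
    constructor
    · exact fun H ht v hA _ => (h7 v).1 (H v ht hA)
    · exact fun H v ht hA => (h7 v).2 (H ht v hA (by simp))
  have h7 : Clausal fun (h : (stepSig st tg F n).Interp D) (I : Inst S D) (J : Inst T D) =>
      ∀ c ∈ cl, ∀ ρ : c.V → Rep _ _ _ I.adom,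
      (∀ A ∈ c.premise, ChrHolds h Subtype.val A.rel (ρ ∘ A.args)) →
      (∀ e ∈ c.eqs, evalRep h Subtype.val ρ e.1 = evalRep h Subtype.val ρ e.2) →
      HeadRep h J Subtype.val ρ c.head := by
    simp only [Rep.forall_iff]
    refine Clausal.forall_mem _ fun c _ => Clausal.forall_finite fun t =>
      (clausal_of_shapes c.premise c.eqs t (liftHead (Rep.generic t) c.head)).congr ?_
    intro h I J
    refine forall_congr' fun v => ?_
    simp only [holds_liftHead, ← headRep_map]
    rfl
  refine (h1.and (h2.and (h3.and (h4.and (h5.and (h6.and h7)))))).congr fun h I J => ?_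
  exact ⟨fun ⟨a, b, c, d, e, f, g⟩ => ⟨a, b, c, d, e, f, g⟩,
    fun ⟨a, b, c, d, e, f, g⟩ => ⟨a, b, c, d, e, f, g⟩⟩

/-- Skolem functions are chosen in `J`, terms are evaluated by them, and the other symbols record
membership in `J` and the values of `φ`. Everything depends on terms only through their values, so
the congruence conditions are automatic. -/
theorem exists_stepSat [Infinite D] {cl : List (FlatClause R T F)} {ℓ : R.Pos → ℕ}
    {pos : ∀ i : Fin tg.length, (tg.get i).U → R.Pos} {I : Inst S D} {J : Inst R D} {K : Inst T D}
    (hIJ : (I, J) ∈ specifiedBy st eg tg) {φ : F.Interp D} (hφ : ∀ c ∈ cl, c.Sat φ J K) :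
    ∃ h : (stepSig st tg F n).Interp D, StepSat eg cl ℓ pos h I K := by
  classical
  obtain ⟨hst, heg, htg⟩ := hIJ
  -- Two distinct values serve as true and false for the characteristic functions; `d₀` is also the
  -- default where a Skolem function has no witness to give.
  obtain ⟨d₀, d₁, hd⟩ := exists_pair_ne D
  have hst' : ∀ (i : Fin st.length) (v : (st.get i).U → D), ∃ w : (st.get i).E → D,
      (∀ A ∈ (st.get i).premise, A.Holds I v) →
      ∀ B ∈ (st.get i).conclusion, B.Holds J (Sum.elim v w) := by
    intro i v
    by_cases hA : ∀ A ∈ (st.get i).premise, A.Holds I v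
    · obtain ⟨w, hw⟩ := hst _ (List.get_mem st i) v hA
      exact ⟨w, fun _ => hw⟩
    · exact ⟨fun _ => d₀, fun H => absurd H hA⟩
  have htg' : ∀ (i : Fin tg.length) (v : (tg.get i).U → D), ∃ w : (tg.get i).E → D,
      (∀ A ∈ (tg.get i).premise, A.Holds J v) →
      ∀ B ∈ (tg.get i).conclusion, B.Holds J (Sum.elim v w) := by
    intro i v
    by_cases hA : ∀ A ∈ (tg.get i).premise, A.Holds J v
    · obtain ⟨w, hw⟩ := htg _ (List.get_mem tg i) v hA
      exact ⟨w, fun _ => hw⟩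
    · exact ⟨fun _ => d₀, fun H => absurd H hA⟩
  choose wst hwst using hst'
  choose wtg hwtg using htg'
  let s : ∀ k : SkSym st tg, (SkArg st tg k → D) → D := fun k => match k with
    | .inl p => fun v => wst p.1 v p.2
    | .inr p => fun v => wtg p.1 v p.2
  let h : (stepSig st tg F n).Interp D := fun f => match f with
    | .val t => fun a => t.1.eval s a
    | .tru => fun _ => d₀
    | .chr r t => fun a =>
      if (fun i => (t i).1.eval s fun j => a ⟨i, j⟩) ∈ J.rel r then d₀ else d₁
    | .fn f t => fun a => φ f fun i => (t i).1.eval s fun j => a ⟨i, j⟩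
  have hchr : ∀ r (ρ : Fin (R.arity r) → Rep (SkSym st tg) (SkArg st tg) (n + 1) I.adom),
      ChrHolds h Subtype.val r ρ ↔ (fun i => value h Subtype.val (ρ i)) ∈ J.rel r := by
    intro r ρ
    change (if (fun i => value h Subtype.val (ρ i)) ∈ J.rel r then d₀ else d₁) = d₀ ↔ _
    split_ifs with hr
    · simp [hr]
    · simp [hr, hd.symm]
  have heval : ∀ {X : Type} (ρ : X → Rep (SkSym st tg) (SkArg st tg) (n + 1) I.adom)
      (t : FlatTerm F X), evalRep h Subtype.val ρ t =
        t.eval φ fun x => value h Subtype.val (ρ x) := by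
    intro X ρ t
    cases t <;> rfl
  refine ⟨h, fun a => rfl, ?_, ?_, ?_, ?_, ?_, ?_⟩
  · intro r ρ h1 h2
    rw [hchr] at h1 ⊢
    exact (funext h2 : (fun i => value h Subtype.val (ρ (.inl i))) = _) ▸ h1
  · intro f ρ h1
    exact congrArg (φ f) (funext h1)
  · intro i B hB v hA
    rw [hchr]
    have := hwst i _ hA B hB
    refine (congrArg (· ∈ J.rel B.rel) (funext fun j => ?_)).mp this
    simp only [Function.comp_apply]
    cases B.args j <;> rfl
  · intro d hd ρ hA
    exact heg d hd (fun x => value h Subtype.val (ρ x)) fun A hmem => (hchr _ _).1 (hA A hmem)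
  · intro i B hB ρ _ hA
    rw [hchr]
    have := hwtg i (fun x => value h Subtype.val (ρ x).succ)
      (fun A hmem => (hchr _ _).1 (hA A hmem)) B hB
    refine (congrArg (· ∈ J.rel B.rel) (funext fun j => ?_)).mp this
    simp only [Function.comp_apply]
    cases B.args j <;> rfl
  · intro c hc ρ hA he
    have := hφ c hc (fun x => value h Subtype.val (ρ x)) (fun A hmem => (hchr _ _).1 (hA A hmem))
      fun e hmem => by rw [← heval, ← heval]; exact he e hmem
    cases hh : c.head with
    | eq a b =>
      rw [hh] at this
      simp only [HeadRep, heval]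
      exact this
    | atom B =>
      rw [hh] at this
      simp only [HeadRep]
      rw [show evalRep h Subtype.val ρ = FlatTerm.eval φ fun x => value h Subtype.val (ρ x) from
        funext (heval ρ)]
      exact this

/-- `J` collects the tuples declared true that have representatives whose depth at each position `p`
is at most `ℓ p`. These bounds are kept by the tgds: a universal variable moves along an ordinary
edge, where `ℓ` does not drop, and a witness adds one level of nesting along special edges, where
`ℓ` grows. Source tgds create depth at most one, hence `1 ≤ ℓ p`. -/
theorem StepSat.exists_inst [Infinite D] {cl : List (FlatClause R T F)} (hcl : ∀ c ∈ cl, c.Safe)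
    {ℓ : R.Pos → ℕ} {pos : ∀ i : Fin tg.length, (tg.get i).U → R.Pos}
    (hpos : ∀ i x, ∃ A ∈ (tg.get i).premise, A.OccursAt x (pos i x))
    (hℓ : ∀ p, 1 ≤ ℓ p ∧ ℓ p ≤ n) (hedge : ∀ p q, Edge tg p q → ℓ p ≤ ℓ q)
    (hspecial : ∀ p q, SpecialEdge tg p q → ℓ p < ℓ q) {I : Inst S D} {K : Inst T D}
    {h : (stepSig st tg F n).Interp D} (H : StepSat eg cl ℓ pos h I K) :
    ∃ J : Inst R D, (I, J) ∈ specifiedBy st eg tg ∧ ∃ φ : F.Interp D, ∀ c ∈ cl, c.Sat φ J K := by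
  let val : Rep (SkSym st tg) (SkArg st tg) (n + 1) I.adom → D := value h Subtype.val
  let J : Inst R D :=
    { rel := fun r => (fun ρ i => val (ρ i)) '' {ρ | (∀ i, (ρ i).1.1 ∈ Shape.level (ℓ ⟨r, i⟩)) ∧
        ChrHolds h Subtype.val r ρ}
      finite := fun r => (Set.toFinite _).image _ }
  -- By congruence a tuple of `J` is declared true for every choice of representatives, whatever
  -- their depth. This lets one representative of a variable serve all its occurrences in a premise.
  have hmem : ∀ {r} (w : Fin (R.arity r) → D)
      (ρ : Fin (R.arity r) → Rep (SkSym st tg) (SkArg st tg) (n + 1) I.adom),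
      w ∈ J.rel r → (∀ i, val (ρ i) = w i) → ChrHolds h Subtype.val r ρ := by
    rintro r _ ρ ⟨ρ', ⟨-, hρ'⟩, rfl⟩ hv
    exact H.chr_congr r (Sum.elim ρ' ρ) hρ' fun i => (hv i).symm
  have hrep : ∀ {X : Type} {A : Atom R X} {v : X → D}, A.Holds J v → ∀ {x p}, A.OccursAt x p →
      ∃ ρ : Rep (SkSym st tg) (SkArg st tg) (n + 1) I.adom, val ρ = v x ∧
        ρ.1.1 ∈ Shape.level (ℓ p) := by
    rintro X A v ⟨ρ, ⟨hl, -⟩, hρ⟩ x p ⟨i, rfl, rfl⟩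
    exact ⟨ρ i, congrFun hρ i, hl i⟩
  have hrep' : ∀ {X : Type} {A : Atom R X} {v : X → D}, A.Holds J v → ∀ {x}, A.Mentions x →
      ∃ ρ : Rep (SkSym st tg) (SkArg st tg) (n + 1) I.adom, val ρ = v x := by
    rintro X A v hA x ⟨i, hi⟩
    obtain ⟨ρ, hρ, -⟩ := hrep hA ⟨i, rfl, hi⟩
    exact ⟨ρ, hρ⟩
  refine ⟨J, ⟨?_, ?_, ?_⟩, ?_⟩
  · intro d hd v hA
    obtain ⟨i, rfl⟩ := List.mem_iff_get.1 hd
    have hv : ∀ x, v x ∈ I.adom := fun x => by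
      obtain ⟨A, hAm, hx⟩ := (st.get i).safe x
      exact (hA A hAm).mem_adom hx
    let v' : (st.get i).U → I.adom := fun x => ⟨v x, hv x⟩
    refine ⟨fun y => val (stRep i v' (.inr y)), fun B hB => ?_⟩
    refine ⟨stRep i v' ∘ B.args, ⟨fun j => ?_, H.st_sat i B hB v' hA⟩, funext fun j => ?_⟩
    · refine Shape.level_mono (hℓ ⟨B.rel, j⟩).1 ?_
      simp only [Function.comp_apply]
      cases B.args j with
      | inl x => exact Shape.var_mem_level _
      | inr y => exact Shape.node_mem_level fun _ => Shape.var_mem_level _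
    · simp only [Function.comp_apply]
      cases B.args j with
      | inl x => exact H.val_var (v' x)
      | inr y => rfl
  · intro d hd v hA
    have hx : ∀ x, ∃ ρ, val ρ = v x := fun x => by
      obtain ⟨A, hAm, hx⟩ := d.safe x
      exact hrep' (hA A hAm) hx
    choose ρ hρ using hx
    rw [← hρ, ← hρ]
    exact H.eg_sat d hd ρ fun A hAm => hmem _ _ (hA A hAm) fun i => hρ _
  · intro d hd v hA
    obtain ⟨i, rfl⟩ := List.mem_iff_get.1 hd
    -- The representative comes from the chosen position of `x`, which bounds its depth by `ℓ (pos i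
    -- x) ≤ n` and leaves room for one more Skolem function.
    have hx : ∀ x, ∃ ρ : Rep (SkSym st tg) (SkArg st tg) n I.adom, val ρ.succ = v x ∧
        ρ.1.1 ∈ Shape.level (ℓ (pos i x)) := fun x => by
      obtain ⟨A, hAm, hx⟩ := hpos i x
      obtain ⟨ρ, hρ, hl⟩ := hrep (hA A hAm) hx
      obtain ⟨ρ, rfl⟩ := Rep.exists_succ_eq (Shape.level_mono (hℓ _).2 hl)
      exact ⟨ρ, hρ, hl⟩
    choose ρ hρ hl using hx
    refine ⟨fun y => val (tgRep i ρ (.inr y)), fun B hB => ?_⟩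
    refine ⟨tgRep i ρ ∘ B.args, ⟨fun j => ?_, H.tg_sat i B hB ρ hl fun A hAm =>
      hmem _ _ (hA A hAm) fun _ => hρ _⟩, funext fun j => ?_⟩
    · simp only [Function.comp_apply]
      cases hj : B.args j with
      | inl x =>
        exact Shape.level_mono (hedge (pos i x) ⟨B.rel, j⟩
          ⟨_, hd, x, hpos i x, B, hB, j, rfl, hj⟩) (hl x)
      | inr y =>
        obtain ⟨m, hm⟩ : ∃ m, ℓ ⟨B.rel, j⟩ = m + 1 :=
          ⟨_, (Nat.sub_add_cancel (hℓ ⟨B.rel, j⟩).1).symm⟩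
        rw [hm]
        refine Shape.node_mem_level fun x => Shape.level_mono ?_ (hl x)
        have := hspecial (pos i x) ⟨B.rel, j⟩ ⟨_, hd, x, y, hpos i x, B, hB, j, rfl, hj⟩
        omega
    · simp only [Function.comp_apply]
      cases B.args j with
      | inl x => exact hρ x
      | inr y => rfl
  · have hφ : ∀ f (w : F.Arg f → D), ∃ a, ∀ ρ : F.Arg f → Rep _ _ _ I.adom,
        (∀ i, val (ρ i) = w i) → fnValue h Subtype.val f ρ = a := by
      intro f w
      by_cases hw : ∃ ρ : F.Arg f → Rep (SkSym st tg) (SkArg st tg) (n + 1) I.adom,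
        ∀ i, val (ρ i) = w i
      · obtain ⟨ρ, hρ⟩ := hw
        exact ⟨fnValue h Subtype.val f ρ, fun ρ' hρ' => H.fn_congr f (Sum.elim ρ' ρ) fun i => (hρ' i).trans (hρ i).symm⟩
      · exact ⟨Classical.arbitrary D, fun ρ hρ => absurd ⟨ρ, hρ⟩ hw⟩
    choose φ hφ using hφ
    refine ⟨φ, fun c hc v hA he => ?_⟩
    have hx : ∀ x, ∃ ρ, val ρ = v x := fun x => by
      obtain ⟨A, hAm, hx⟩ := hcl c hc x
      exact hrep' (hA A hAm) hx
    choose ρ hρ using hx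
    have heval : ∀ t : FlatTerm F c.V, evalRep h Subtype.val ρ t = t.eval φ v := by
      intro t
      cases t with
      | var x => exact hρ x
      | app f xs => exact hφ f _ _ fun i => hρ _
    have := H.cl_sat c hc ρ (fun A hAm => hmem _ _ (hA A hAm) fun i => hρ _)
      fun e hem => by rw [heval, heval]; exact he e hem
    cases hh : c.head with
    | eq a b =>
      rw [hh] at this
      simp only [HeadRep, heval] at this
      exact this
    | atom B =>
      rw [hh] at this
      simp only [HeadRep] at this
      rw [show evalRep h Subtype.val ρ = FlatTerm.eval φ v from funext heval] at this
      exact this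

end Composition

/-- The composition of a standard mapping with a flat dependency is given by a flat dependency. -/
theorem FlatDep.exists_comp {S R T : Schema} {D : Type*} [Infinite D] (st : List (Tgd S R))
    (eg : List (Egd R)) {tg : List (Tgd R R)} (htg : WeaklyAcyclic tg) (σ : FlatDep R T) :
    ∃ τ : FlatDep S T, ∀ (I : Inst S D) (K : Inst T D),
      τ.Sat I K ↔ ∃ J, (I, J) ∈ specifiedBy st eg tg ∧ σ.Sat J K := by
  obtain ⟨r, hedge, hspecial⟩ := htg.exists_rank
  obtain ⟨b, hb⟩ := (Set.finite_range r).bddAbove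
  have hpos : ∀ (i : Fin tg.length) (x : (tg.get i).U), ∃ p : R.Pos,
      ∃ A ∈ (tg.get i).premise, A.OccursAt x p := by
    intro i x
    obtain ⟨A, hA, j, hj⟩ := (tg.get i).safe x
    exact ⟨⟨A.rel, j⟩, A, hA, j, rfl, hj⟩
  choose pos hpos using hpos
  -- Depth bounds are ranks plus one, since a source tgd may put a term of depth one at a position
  -- of rank zero; `b + 1` bounds them all.
  obtain ⟨τ, hτ⟩ := (clausal_stepSat (D := D) (st := st) (eg := eg) (n := b + 1) σ.clauses
    (fun p => r p + 1) pos).exists_flatDep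
  refine ⟨τ, fun I K => (hτ I K).trans ⟨?_, ?_⟩⟩
  · rintro ⟨h, H⟩
    exact H.exists_inst σ.safe hpos (fun p => ⟨by omega, by
      have := hb (Set.mem_range_self p); omega⟩) (fun p q hpq => by
      have := hedge p q hpq; omega) fun p q hpq => by have := hspecial p q hpq; omega
  · rintro ⟨J, hJ, φ, hφ⟩
    exact exists_stepSat hJ hφ


/-! ### Standard compositions are given by flat dependencies -/

/-- The dependency that says that the source is contained in the target. -/
noncomputable def copyDep (T : Schema) : FlatDep T T where
  F := { Sym := Empty, Arg := fun _ => Empty }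
  clauses := (enum T.Rel).map fun r => ⟨Fin (T.arity r), [⟨r, id⟩], [], .atom ⟨r, .var⟩⟩
  safe := by
    intro c hc
    obtain ⟨r, -, rfl⟩ := List.mem_map.1 hc
    exact fun x => ⟨_, List.mem_singleton_self _, x, rfl⟩

theorem copyDep_sat {T : Schema} {D : Type*} (I J : Inst T D) :
    (copyDep T).Sat I J ↔ ∀ r, I.rel r ⊆ J.rel r := by
  constructor
  · rintro ⟨h, H⟩ r w hw
    exact H _ (List.mem_map.2 ⟨r, mem_enum r, rfl⟩) w
      (fun A hA => by rw [List.mem_singleton.1 hA]; exact hw)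
      fun e he => absurd he List.not_mem_nil
  · refine fun H => ⟨fun f => f.elim, fun c hc => ?_⟩
    obtain ⟨r, -, rfl⟩ := List.mem_map.1 hc
    exact fun v hA _ => H r (hA _ (List.mem_singleton_self _))

theorem Tgd.Sat.mono {S T : Schema} {D : Type*} {d : Tgd S T} {I : Inst S D} {J J' : Inst T D}
    (h : d.Sat I J) (hJ : ∀ r, J.rel r ⊆ J'.rel r) : d.Sat I J' := fun v hv =>
  (h v hv).imp fun _ hw B hB => hJ _ (hw B hB)

theorem weaklyAcyclic_nil {T : Schema} : WeaklyAcyclic ([] : List (Tgd T T)) := by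
  rintro p q ⟨d, hd, -⟩
  simp at hd

/-- The mapping specified by a flat dependency, t-egds and t-tgds. -/
def specifiedByFlat {D : Type*} {S T : Schema} (σ : FlatDep S T) (egds : List (Egd T))
    (tgds : List (Tgd T T)) : SchemaMapping D S T :=
  {p | σ.Sat p.1 p.2 ∧ (∀ d ∈ egds, d.Sat p.2) ∧ ∀ d ∈ tgds, d.Sat p.2 p.2}

/-- Mappings are absorbed from the left by `FlatDep.exists_comp`. For a single mapping, its st-tgds
are composed with the containment dependency `copyDep`: conclusions of tgds are monotone, so `J`
satisfies them if and only if some `J' ⊆ J` does. This performs the Skolemization. -/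
theorem IsStandardComposition.exists_flatDep {D : Type*} [Infinite D] {S T : Schema}
    {M : SchemaMapping D S T} (hM : IsStandardComposition M) :
    ∃ (σ : FlatDep S T) (egds : List (Egd T)) (tgds : List (Tgd T T)),
      WeaklyAcyclic tgds ∧ M = specifiedByFlat σ egds tgds := by
  induction hM with
  | @single S T M hM =>
    obtain ⟨st, eg, tg, htg, rfl⟩ := hM
    obtain ⟨τ, hτ⟩ := FlatDep.exists_comp (D := D) st [] weaklyAcyclic_nil (copyDep T)
    refine ⟨τ, eg, tg, htg, Set.ext fun ⟨I, J⟩ => and_congr_left fun _ => ?_⟩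
    simp only [hτ, copyDep_sat, specifiedBy, Set.mem_ofPred_eq, List.not_mem_nil,
      IsEmpty.forall_iff, implies_true, and_true]
    exact ⟨fun H => ⟨J, H, fun _ => subset_rfl⟩, fun ⟨J', H, hJ⟩ d hd => (H d hd).mono hJ⟩
  | @comp S R T M N hM _ ih =>
    obtain ⟨st, eg, tg, htg, rfl⟩ := hM
    obtain ⟨σ, eg', tg', htg', rfl⟩ := ih
    obtain ⟨τ, hτ⟩ := FlatDep.exists_comp (D := D) st eg htg σ
    refine ⟨τ, eg', tg', htg', Set.ext fun ⟨I, K⟩ => ?_⟩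
    simp only [specifiedByFlat, SetRel.mem_comp, Set.mem_ofPred_eq, hτ]
    exact ⟨fun ⟨J, h1, h2, h3⟩ => ⟨⟨J, h1, h2⟩, h3⟩, fun ⟨⟨J, h1, h2⟩, h3⟩ => ⟨J, h1, h2, h3⟩⟩

/-! ### Flat dependencies as unnested st-SO dependencies -/

namespace Signature

variable (F : Signature)

/-- The numbering of the arguments of a symbol. -/
noncomputable def argEquiv (f : F.Sym) : F.Arg f ≃ Fin (Nat.card (F.Arg f)) :=
  Finite.equivFin _

/-- The first-order language of a signature. -/
def language : FirstOrder.Language.{0, 0} where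
  Functions n := {f : F.Sym // Nat.card (F.Arg f) = n}
  Relations _ := Empty

instance : F.language.IsAlgebraic := fun _ => inferInstanceAs (IsEmpty Empty)

instance : Finite ((n : ℕ) × F.language.Functions n) := by
  refine Finite.of_injective (fun p : (n : ℕ) × {f : F.Sym // Nat.card (F.Arg f) = n} => p.2.1) ?_
  rintro ⟨_, f, rfl⟩ ⟨_, g, rfl⟩ (rfl : f = g)
  rfl

variable {F} {D : Type*}

/-- A structure for the language of a signature interprets the signature. -/
noncomputable def interpOf (str : F.language.Structure D) : F.Interp D := fun f a =>
  str.funMap (n := Nat.card (F.Arg f)) ⟨f, rfl⟩ (a ∘ (F.argEquiv f).symm)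

/-- Only the numbering of arguments changes, so every interpretation of the signature comes from a
structure for its language. -/
theorem exists_interpOf_eq (h : F.Interp D) :
    ∃ str : F.language.Structure D, interpOf str = h := by
  refine ⟨⟨fun {n} f a => h f.1 fun i => a (Fin.cast f.2 (F.argEquiv f.1 i)),
    fun r => (r : Empty).elim⟩, ?_⟩
  funext f a
  simp [interpOf]

end Signature

namespace FlatTerm

variable {F : Signature} {V : Type} {D : Type*}

/-- A flat term as a term of the language. -/
noncomputable def toTerm : FlatTerm F V → F.language.Term V
  | var x => .var x
  | app f xs => .func (l := Nat.card (F.Arg f)) ⟨f, rfl⟩ fun i =>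
      .var (xs ((F.argEquiv f).symm i))

theorem depth_toTerm (t : FlatTerm F V) : depth t.toTerm ≤ 1 := by
  cases t with
  | var x => simp [toTerm, depth]
  | app f xs =>
    simp only [toTerm, depth]
    split_ifs
    · exact zero_le_one
    · simp

theorem realize_toTerm [str : F.language.Structure D] (v : V → D) (t : FlatTerm F V) :
    t.toTerm.realize v = t.eval (Signature.interpOf str) v := by
  cases t <;> rfl

end FlatTerm

/-- A safe flat clause as a conjunct of an st-SO dependency. -/
noncomputable def FlatClause.toSOClause {S T : Schema} {F : Signature} (c : FlatClause S T F)
    (hc : c.Safe) : SOClause S T F.language where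
  V := c.V
  premise := c.premise
  premiseEqs := c.eqs.map fun e => (e.1.toTerm, e.2.toTerm)
  conclusion := match c.head with
    | .eq _ _ => []
    | .atom B => [B.map FlatTerm.toTerm]
  conclusionEqs := match c.head with
    | .eq s t => [(s.toTerm, t.toTerm)]
    | .atom _ => []
  safe := hc

theorem FlatClause.toSOClause_unnested {S T : Schema} {F : Signature} (c : FlatClause S T F)
    (hc : c.Safe) : (c.toSOClause hc).Unnested := by
  obtain ⟨V, prem, eqs, head⟩ := c
  refine ⟨fun e he => ?_, fun B hB i => ?_, fun e he => ?_⟩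
  · obtain ⟨e, -, rfl⟩ := List.mem_map.1 he
    exact ⟨e.1.depth_toTerm, e.2.depth_toTerm⟩
  · cases head with
    | eq s t => exact absurd hB List.not_mem_nil
    | atom B' =>
      obtain rfl := List.mem_singleton.1 hB
      exact (B'.args i).depth_toTerm
  · cases head with
    | eq s t =>
      obtain rfl := List.mem_singleton.1 he
      exact ⟨s.depth_toTerm, t.depth_toTerm⟩
    | atom B => exact absurd he List.not_mem_nil

theorem FlatClause.toSOClause_sat {S T : Schema} {F : Signature} {D : Type*}
    [str : F.language.Structure D] (c : FlatClause S T F) (hc : c.Safe) (I : Inst S D)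
    (J : Inst T D) :
    (c.toSOClause hc).Sat I J ↔ c.Sat (Signature.interpOf str) I J := by
  obtain ⟨V, prem, eqs, head⟩ := c
  refine forall_congr' fun v => imp_congr Iff.rfl (imp_congr ?_ ?_)
  · constructor
    · exact fun H e he => (FlatTerm.realize_toTerm v e.1).symm.trans
        ((H _ (List.mem_map.2 ⟨e, he, rfl⟩)).trans (FlatTerm.realize_toTerm v e.2))
    · intro H e he
      obtain ⟨e, he', rfl⟩ := List.mem_map.1 he
      exact (FlatTerm.realize_toTerm v e.1).trans
        ((H e he').trans (FlatTerm.realize_toTerm v e.2).symm)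
  · cases head with
    | eq s t =>
      constructor
      · rintro ⟨-, H⟩
        exact (FlatTerm.realize_toTerm v s).symm.trans
          ((H _ (List.mem_singleton_self _)).trans (FlatTerm.realize_toTerm v t))
      · intro H
        refine ⟨fun B hB => absurd hB List.not_mem_nil, fun e he => ?_⟩
        rw [List.mem_singleton.1 he]
        exact (FlatTerm.realize_toTerm v s).trans (H.trans (FlatTerm.realize_toTerm v t).symm)
    | atom B =>
      have hB : (B.map FlatTerm.toTerm).Holds J (fun t => t.realize v) ↔
          B.Holds J (FlatTerm.eval (Signature.interpOf str) v) := by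
        rw [Atom.holds_map, show (fun t : F.language.Term V => t.realize v) ∘ FlatTerm.toTerm =
          FlatTerm.eval (Signature.interpOf str) v from funext (FlatTerm.realize_toTerm v)]
        rfl
      constructor
      · exact fun H => hB.1 (H.1 _ (List.mem_singleton_self _))
      · refine fun H => ⟨fun B' hB' => ?_, fun e he => absurd he List.not_mem_nil⟩
        rw [List.mem_singleton.1 hB']
        exact hB.2 H

/-- A flat dependency as an st-SO dependency. -/
noncomputable def FlatDep.toSODep {S T : Schema} (σ : FlatDep S T) : SODep S T where
  L := σ.F.language
  clauses := σ.clauses.attach.map fun c => c.1.toSOClause (σ.safe c.1 c.2)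

theorem FlatDep.toSODep_unnested {S T : Schema} (σ : FlatDep S T) : σ.toSODep.Unnested := by
  intro c hc
  obtain ⟨c, -, rfl⟩ := List.mem_map.1 hc
  exact c.1.toSOClause_unnested _

theorem FlatDep.toSODep_sat {S T : Schema} {D : Type*} (σ : FlatDep S T) (I : Inst S D)
    (J : Inst T D) : σ.toSODep.Sat I J ↔ σ.Sat I J := by
  have key : ∀ str : σ.F.language.Structure D, 
      (∀ c : SOClause S T σ.F.language, c ∈ σ.toSODep.clauses → c.Sat I J) ↔
      ∀ c ∈ σ.clauses, c.Sat (Signature.interpOf str) I J := by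
    intro str
    constructor
    · exact fun H c hc => (c.toSOClause_sat (σ.safe c hc) I J).1
        (H _ (List.mem_map.2 ⟨⟨c, hc⟩, List.mem_attach _ _, rfl⟩))
    · intro H c hc
      obtain ⟨c, -, rfl⟩ := List.mem_map.1 hc
      exact (c.1.toSOClause_sat (σ.safe c.1 c.2) I J).2 (H c.1 c.2)
  constructor
  · rintro ⟨str, H⟩
    exact ⟨_, (key str).1 H⟩
  · rintro ⟨h, H⟩
    obtain ⟨str, rfl⟩ := Signature.exists_interpOf_eq h
    exact ⟨str, (key str).2 H⟩

/-! ### Flat dependencies as compositions of two standard mappings -/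

/-- The arguments of the atom saying that `y` is the value of `f` at `xs`. -/
noncomputable def Signature.graphArgs {F : Signature} {τ : Type*} (f : F.Sym) (y : τ)
    (xs : F.Arg f → τ) : Fin (Nat.card (F.Arg f) + 1) → τ :=
  Fin.cons y (xs ∘ (F.argEquiv f).symm)

theorem Signature.comp_graphArgs {F : Signature} {τ τ' : Type*} (v : τ → τ') (f : F.Sym) (y : τ)
    (xs : F.Arg f → τ) : v ∘ graphArgs f y xs = graphArgs f (v y) (v ∘ xs) :=
  Fin.comp_cons _ _ _

theorem Signature.graphArgs_inj {F : Signature} {τ : Type*} {f : F.Sym} {y y' : τ}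
    {xs xs' : F.Arg f → τ} (h : graphArgs f y xs = graphArgs f y' xs') : y = y' ∧ xs = xs' := by
  obtain ⟨h1, h2⟩ := Fin.cons_injective2 h
  exact ⟨h1, (F.argEquiv f).symm.surjective.injective_comp_right h2⟩

/-- The schema with a copy of `S` and a relation for the graph of every function symbol. -/
noncomputable def graphSchema (S : Schema) (F : Signature) : Schema where
  Rel := S.Rel ⊕ F.Sym
  arity := Sum.elim S.arity fun f => Nat.card (F.Arg f) + 1
  arity_pos := by
    rintro (r | f)
    · exact S.arity_pos r
    · exact Nat.succ_pos _

section Graph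

variable {S T : Schema} {F : Signature} {D : Type*} {τ : Type}

/-- The copy of an atom. -/
def copyAtom (A : Atom S τ) : Atom (graphSchema S F) τ := ⟨.inl A.rel, A.args⟩

/-- The atom saying that `y` is the value of `f` at `xs`. -/
noncomputable def graphAtom (f : F.Sym) (y : τ) (xs : F.Arg f → τ) :
    Atom (graphSchema S F) τ := ⟨.inr f, Signature.graphArgs f y xs⟩

theorem graphAtom_mentions_left (f : F.Sym) (y : τ) (xs : F.Arg f → τ) :
    (graphAtom (S := S) f y xs).Mentions y := ⟨(0 : Fin (Nat.card (F.Arg f) + 1)), rfl⟩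

theorem graphAtom_mentions_right (f : F.Sym) (y : τ) (xs : F.Arg f → τ) (i : F.Arg f) :
    (graphAtom (S := S) f y xs).Mentions (xs i) :=
  ⟨(F.argEquiv f i).succ, congrArg xs ((F.argEquiv f).symm_apply_apply i)⟩

theorem graphAtom_holds (J : Inst (graphSchema S F) D) (v : τ → D) (f : F.Sym) (y : τ)
    (xs : F.Arg f → τ) :
    (graphAtom f y xs).Holds J v ↔ Signature.graphArgs f (v y) (v ∘ xs) ∈ J.rel (.inr f) := by
  rw [← Signature.comp_graphArgs]
  rfl

/-- The tgd that copies a relation. -/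
noncomputable def copyTgd (S : Schema) (F : Signature) (r : S.Rel) : Tgd S (graphSchema S F) where
  U := Fin (S.arity r)
  E := Empty
  premise := [⟨r, id⟩]
  conclusion := [copyAtom ⟨r, .inl⟩]
  safe x := ⟨_, List.mem_singleton_self _, x, rfl⟩

/-- The tgd saying that `f` has a value at tuples of source values from given positions. -/
noncomputable def totalTgd (f : F.Sym) (g : F.Arg f → S.Pos) : Tgd S (graphSchema S F) where
  U := (i : F.Arg f) × Fin (S.arity (g i).1)
  E := Unit
  premise := (enum (F.Arg f)).map fun i => ⟨(g i).1, fun j => ⟨i, j⟩⟩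
  conclusion := [graphAtom f (.inr ()) fun i => .inl ⟨i, (g i).2⟩]
  safe := fun ⟨i, j⟩ => ⟨_, List.mem_map.2 ⟨i, mem_enum i, rfl⟩, j, rfl⟩

/-- The egd saying that `f` has at most one value. -/
noncomputable def functionalEgd (S : Schema) (f : F.Sym) : Egd (graphSchema S F) where
  U := F.Arg f ⊕ Bool
  premise := [graphAtom f (.inr true) .inl, graphAtom f (.inr false) .inl]
  lhs := .inr true
  rhs := .inr false
  safe := by
    rintro (i | _ | _)
    · exact ⟨_, List.mem_cons_self, graphAtom_mentions_right f _ _ i⟩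
    · exact ⟨_, List.mem_cons_of_mem _ (List.mem_singleton_self _), graphAtom_mentions_left f _ _⟩
    · exact ⟨_, List.mem_cons_self, graphAtom_mentions_left f _ _⟩

/-! ### Clauses as egds and tgds over the graph schema -/

namespace FlatClause

variable (c : FlatClause S T F)

/-- A variable for every flat term, with variables identified according to the premise. -/
abbrev TermVar : Type := Quot fun s t : FlatTerm F c.V => (s, t) ∈ c.eqs

/-- The premise of the clause over the graph schema. -/
noncomputable def graphPremise : List (Atom (graphSchema S F) c.TermVar) :=
  (c.premise.map fun A => copyAtom (A.map fun x => Quot.mk _ (.var x))) ++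
    (enum ((f : F.Sym) × (F.Arg f → c.V))).map fun p =>
      graphAtom p.1 (Quot.mk _ (.app p.1 p.2)) fun i => Quot.mk _ (.var (p.2 i))

variable {c}

/-- Every class contains a flat term: a variable occurs by safety of the clause, and an application
occurs as the value in its own graph atom. -/
theorem graphPremise_safe (hc : c.Safe) (x : c.TermVar) :
    ∃ A ∈ c.graphPremise, A.Mentions x := by
  obtain ⟨t, rfl⟩ := Quot.exists_rep x
  cases t with
  | var x =>
    obtain ⟨A, hA, i, rfl⟩ := hc x
    exact ⟨_, List.mem_append_left _ (List.mem_map.2 ⟨A, hA, rfl⟩), i, rfl⟩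
  | app f xs =>
    exact ⟨_, List.mem_append_right _ (List.mem_map.2 ⟨⟨f, xs⟩, mem_enum _, rfl⟩),
      graphAtom_mentions_left _ _ _⟩

theorem graphPremise_holds {J : Inst (graphSchema S F) D} {v : c.TermVar → D} :
    (∀ A ∈ c.graphPremise, A.Holds J v) ↔
      (∀ A ∈ c.premise, (fun i => v (Quot.mk _ (.var (A.args i)))) ∈ J.rel (.inl A.rel)) ∧
      ∀ f xs, Signature.graphArgs f (v (Quot.mk _ (.app f xs)))
        (fun i => v (Quot.mk _ (.var (xs i)))) ∈ J.rel (.inr f) := by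
  simp only [graphPremise, List.mem_append, List.mem_map, mem_enum, true_and]
  constructor
  · exact fun H => ⟨fun A hA => H _ (.inl ⟨A, hA, rfl⟩),
      fun f xs => (graphAtom_holds J v _ _ _).1 (H _ (.inr ⟨⟨f, xs⟩, rfl⟩))⟩
  · rintro ⟨h1, h2⟩ _ (⟨A, hA, rfl⟩ | ⟨⟨f, xs⟩, rfl⟩)
    · exact h1 A hA
    · exact (graphAtom_holds J v _ _ _).2 (h2 f xs)

variable (c)

/-- The egds over the graph schema for a clause. -/
noncomputable def graphEgds (hc : c.Safe) : List (Egd (graphSchema S F)) :=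
  match c.head with
  | .eq s t => [⟨c.TermVar, c.graphPremise, Quot.mk _ s, Quot.mk _ t, graphPremise_safe hc⟩]
  | .atom _ => []

/-- The tgds from the graph schema for a clause. -/
noncomputable def graphTgds (hc : c.Safe) : List (Tgd (graphSchema S F) T) :=
  match c.head with
  | .eq _ _ => []
  | .atom B => [⟨c.TermVar, Empty, c.graphPremise, [B.map fun t => .inl (Quot.mk _ t)],
      graphPremise_safe hc⟩]

theorem graph_sat (hc : c.Safe) (J : Inst (graphSchema S F) D) (K : Inst T D) :
    ((∀ d ∈ c.graphEgds hc, d.Sat J) ∧ ∀ d ∈ c.graphTgds hc, d.Sat J K) ↔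
      ∀ v : c.TermVar → D, (∀ A ∈ c.graphPremise, A.Holds J v) →
        match c.head with
        | .eq s t => v (Quot.mk _ s) = v (Quot.mk _ t)
        | .atom B => B.Holds K fun t => v (Quot.mk _ t) := by
  unfold graphEgds graphTgds
  cases c.head with
  | eq s t =>
    simp only [List.mem_singleton, forall_eq, List.not_mem_nil, IsEmpty.forall_iff, implies_true,
      and_true]
    rfl
  | atom B =>
    simp only [List.mem_singleton, forall_eq, List.not_mem_nil, IsEmpty.forall_iff, implies_true,
      true_and]
    refine forall_congr' fun v => imp_congr Iff.rfl ?_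
    constructor
    · rintro ⟨w, hw⟩
      exact hw _ (List.mem_singleton_self _)
    · intro h
      refine ⟨fun y => y.elim, fun B' hB' => ?_⟩
      rw [List.mem_singleton.1 hB']
      exact h

end FlatClause

/-- The instance with a copy of `I` and the graphs of the functions on the active domain. -/
noncomputable def graphInst (I : Inst S D) (h : F.Interp D) : Inst (graphSchema S F) D where
  rel
    | .inl r => I.rel r
    | .inr f => Set.range fun a : F.Arg f → I.adom =>
        Signature.graphArgs f (h f (Subtype.val ∘ a)) (Subtype.val ∘ a)
  finite
    | .inl r => I.finite r
    | .inr _ => Set.finite_range _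

end Graph

/-! ### Factoring a flat dependency through the graph schema -/

namespace FlatDep

variable {S T : Schema} {D : Type*} (σ : FlatDep S T)

/-- The tgds of the first mapping. -/
noncomputable def firstTgds : List (Tgd S (graphSchema S σ.F)) :=
  (enum S.Rel).map (copyTgd S σ.F) ++
    (enum ((f : σ.F.Sym) × (σ.F.Arg f → S.Pos))).map fun p => totalTgd p.1 p.2

/-- The egds of the first mapping. -/
noncomputable def firstEgds : List (Egd (graphSchema S σ.F)) :=
  (enum σ.F.Sym).map (functionalEgd S) ++
    σ.clauses.attach.flatMap fun c => c.1.graphEgds (σ.safe c.1 c.2)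

/-- The tgds of the second mapping. -/
noncomputable def secondTgds : List (Tgd (graphSchema S σ.F) T) :=
  σ.clauses.attach.flatMap fun c => c.1.graphTgds (σ.safe c.1 c.2)

variable {σ}

/-- The witness is the copy of `I` with the graphs of the functions restricted to the active domain,
which keeps it finite. -/
theorem exists_graph_of_sat {I : Inst S D} {K : Inst T D} (H : σ.Sat I K) :
    ∃ J, (∀ d ∈ σ.firstTgds, d.Sat I J) ∧ (∀ d ∈ σ.firstEgds, d.Sat J) ∧
      ∀ d ∈ σ.secondTgds, d.Sat J K := by
  obtain ⟨h, H⟩ := H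
  have hgraph : ∀ {f y a}, Signature.graphArgs f y a ∈ (graphInst I h).rel (.inr f) →
      y = h f a := by
    rintro f y a ⟨a', ha'⟩
    obtain ⟨rfl, rfl⟩ := Signature.graphArgs_inj ha'
    rfl
  have hclause : ∀ c (hc : c ∈ σ.clauses),
      (∀ d ∈ c.graphEgds (σ.safe c hc), d.Sat (graphInst I h)) ∧
        ∀ d ∈ c.graphTgds (σ.safe c hc), d.Sat (graphInst I h) K := by
    intro c hc
    rw [FlatClause.graph_sat]
    intro v hv
    obtain ⟨h1, h2⟩ := FlatClause.graphPremise_holds.1 hv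
    -- The graph atoms force `v` to give each flat term its true value. Terms equated in the premise
    -- share a variable, so their values agree.
    have heval : (fun t => v (Quot.mk _ t)) =
        FlatTerm.eval h fun x => v (Quot.mk _ (.var x)) := by
      funext t
      cases t with
      | var x => rfl
      | app f xs => exact hgraph (h2 f xs)
    have := H c hc (fun x => v (Quot.mk _ (.var x))) h1 fun e he => by
      rw [← heval]
      exact congrArg v (Quot.sound he)
    cases hh : c.head with
    | eq s t =>
      rw [hh, Head.Holds, ← heval] at this
      exact this
    | atom B =>
      rw [hh, Head.Holds, ← heval] at this
      exact this
  refine ⟨graphInst I h, ?_, ?_, ?_⟩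
  · intro d hd
    rcases List.mem_append.1 hd with hd | hd
    · obtain ⟨r, -, rfl⟩ := List.mem_map.1 hd
      intro v hv
      refine ⟨fun y => y.elim, fun B hB => ?_⟩
      rw [List.mem_singleton.1 hB]
      exact hv _ (List.mem_singleton_self _)
    · obtain ⟨⟨f, g⟩, -, rfl⟩ := List.mem_map.1 hd
      intro v hv
      let a : σ.F.Arg f → I.adom := fun i => ⟨v ⟨i, (g i).2⟩, g i, _,
        hv _ (List.mem_map.2 ⟨i, mem_enum i, rfl⟩), rfl⟩
      refine ⟨fun _ => h f (Subtype.val ∘ a), fun B hB => ?_⟩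
      rw [List.mem_singleton.1 hB]
      exact (graphAtom_holds _ _ _ _ _).2 ⟨a, rfl⟩
  · intro d hd
    rcases List.mem_append.1 hd with hd | hd
    · obtain ⟨f, -, rfl⟩ := List.mem_map.1 hd
      intro v hv
      have h1 := (graphAtom_holds _ v _ _ _).1 (hv _ List.mem_cons_self)
      have h2 := (graphAtom_holds _ v _ _ _).1
        (hv _ (List.mem_cons_of_mem _ (List.mem_singleton_self _)))
      exact (hgraph h1).trans (hgraph h2).symm
    · obtain ⟨⟨c, hc⟩, -, hd⟩ := List.mem_flatMap.1 hd
      exact (hclause c hc).1 d hd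
  · intro d hd
    obtain ⟨⟨c, hc⟩, -, hd⟩ := List.mem_flatMap.1 hd
    exact (hclause c hc).2 d hd

/-- `J` may contain more than the copy and the graphs, but this does no harm: its functional
relations still determine the functions, and extra tuples only add instances of the clauses. -/
theorem sat_of_graph [Nonempty D] {I : Inst S D} {J : Inst (graphSchema S σ.F) D} {K : Inst T D}
    (h1 : ∀ d ∈ σ.firstTgds, d.Sat I J) (h2 : ∀ d ∈ σ.firstEgds, d.Sat J)
    (h3 : ∀ d ∈ σ.secondTgds, d.Sat J K) : σ.Sat I K := by
  have hcopy : ∀ r, I.rel r ⊆ J.rel (.inl r) := by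
    intro r w hw
    obtain ⟨_, hB⟩ := h1 _ (List.mem_append_left _ (List.mem_map.2 ⟨r, mem_enum r, rfl⟩)) w
      fun A hA => by rw [List.mem_singleton.1 hA]; exact hw
    exact hB _ (List.mem_singleton_self _)
  have htotal : ∀ f (a : σ.F.Arg f → I.adom),
      ∃ y, Signature.graphArgs f y (Subtype.val ∘ a) ∈ J.rel (.inr f) := by
    intro f a
    choose g w hw ha using fun i => (a i).2
    obtain ⟨y, hB⟩ := h1 (totalTgd f g)
      (List.mem_append_right _ (List.mem_map.2 ⟨⟨f, g⟩, mem_enum _, rfl⟩))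
      (fun p => w p.1 p.2) fun A hA => by
        obtain ⟨i, -, rfl⟩ := List.mem_map.1 hA
        exact hw i
    have := (graphAtom_holds _ _ _ _ _).1 (hB _ (List.mem_singleton_self _))
    refine ⟨y (), ?_⟩
    rw [show Subtype.val ∘ a = _ from (funext ha).symm]
    exact this
  have hfun : ∀ {f y y' a}, Signature.graphArgs f y a ∈ J.rel (.inr f) →
      Signature.graphArgs f y' a ∈ J.rel (.inr f) → y = y' := by
    intro f y y' a hy hy'
    refine h2 (functionalEgd S f)
      (List.mem_append_left _ (List.mem_map.2 ⟨f, mem_enum f, rfl⟩))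
      (Sum.elim a fun b => if b then y else y') fun A hA => ?_
    rcases List.mem_cons.1 hA with rfl | hA
    · exact (graphAtom_holds _ _ _ _ _).2 hy
    · rw [List.mem_singleton.1 hA]
      exact (graphAtom_holds _ _ _ _ _).2 hy'
  -- Where the graph relation gives no value, the function takes an arbitrary one.
  have hval : ∀ f (a : σ.F.Arg f → D), ∃ y, ∀ y',
      Signature.graphArgs f y' a ∈ J.rel (.inr f) → y' = y := by
    intro f a
    by_cases hy : ∃ y, Signature.graphArgs f y a ∈ J.rel (.inr f)
    · obtain ⟨y, hy⟩ := hy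
      exact ⟨y, fun y' hy' => hfun hy' hy⟩
    · exact ⟨Classical.arbitrary D, fun y' hy' => absurd ⟨y', hy'⟩ hy⟩
  choose h hh using hval
  refine ⟨h, fun c hc v hA he => ?_⟩
  have hclause := (c.graph_sat (σ.safe c hc) J K).1
    ⟨fun d hd => h2 d (List.mem_append_right _
      (List.mem_flatMap.2 ⟨⟨c, hc⟩, List.mem_attach _ _, hd⟩)),
    fun d hd => h3 d (List.mem_flatMap.2 ⟨⟨c, hc⟩, List.mem_attach _ _, hd⟩)⟩
    -- Evaluation descends to the quotient because `v` satisfies the premise equalities `he`.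
    (Quot.lift (FlatTerm.eval h v) fun s t hst => he (s, t) hst)
    (FlatClause.graphPremise_holds.2 ⟨fun A hAm => hcopy _ (hA A hAm), fun f xs => ?_⟩)
  · cases hh : c.head with
    | eq s t =>
      rw [hh] at hclause
      exact hclause
    | atom B =>
      rw [hh] at hclause
      exact hclause
  -- Safety puts the arguments in the active domain, where totality supplies a graph tuple;
  -- single-valuedness identifies its value with that of `h`.
  · have hv : ∀ x, v x ∈ I.adom := fun x => by
      obtain ⟨A, hAm, hx⟩ := σ.safe c hc x
      exact (hA A hAm).mem_adom hx
    obtain ⟨y, hy⟩ := htotal f fun i => ⟨v (xs i), hv _⟩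
    have := hh f _ y hy
    rw [this] at hy
    exact hy

end FlatDep

end DataExchange

/-! ### The theorem -/

theorem corollary7p7 {D : Type*} [Countable D] [Infinite D] {S T : DataExchange.Schema}
    (M : DataExchange.SchemaMapping D S T) (hM : DataExchange.IsStandardComposition M) :
    DataExchange.IsUnnestedSOStandard M ∧
      ∃ (R : DataExchange.Schema) (M₁ : DataExchange.SchemaMapping D S R)
        (M₂ : DataExchange.SchemaMapping D R T),
        DataExchange.IsStandardEgdOnly M₁ ∧ DataExchange.IsStandard M₂ ∧
          M = SetRel.comp M₁ M₂ := by
  obtain ⟨σ, egds, tgds, htgds, rfl⟩ := hM.exists_flatDep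
  -- Both parts start from the same flat dependency and keep the same constraints on the final
  -- schema.
  refine ⟨⟨σ.toSODep, egds, tgds, σ.toSODep_unnested, htgds, Set.ext fun ⟨I, J⟩ =>
    and_congr_left fun _ => (σ.toSODep_sat I J).symm⟩,
    DataExchange.graphSchema S σ.F, DataExchange.specifiedBy σ.firstTgds σ.firstEgds [],
    DataExchange.specifiedBy σ.secondTgds egds tgds, ⟨_, _, rfl⟩, ⟨_, _, _, htgds, rfl⟩,
    Set.ext fun ⟨I, K⟩ => ?_⟩
  constructor
  · rintro ⟨h, hK⟩
    obtain ⟨J, h1, h2, h3⟩ := DataExchange.FlatDep.exists_graph_of_sat h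
    exact ⟨J, ⟨h1, h2, by simp⟩, h3, hK⟩
  · rintro ⟨J, ⟨h1, h2, -⟩, h3, hK⟩
    exact ⟨DataExchange.FlatDep.sat_of_graph h1 h2 h3, hK⟩
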